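/- Let $X$ be a finite or countably infinite set, $K$ an irreducible Markov kernel on $X$ (so $K(x,y)\ge 0$ and $\sum_y K(x,y)=1$ for all $x$), and $\pi$ a probability measure on $X$ with $K(x,y)\pi(x)=K(y,x)\pi(y)$ for all $x,y$. Put $$Lf(x)=\sum_y (f(y)-f(x))K(x,y),\qquad \Gamma(f,g)(x)=\frac12\sum_y (f(y)-f(x))(g(y)-g(x))K(x,y),\qquad \Gamma(f)=\Gamma(f,f),$$ $\Gamma_2(f)=\frac12 L\Gamma(f)-\Gamma(f,Lf)$, and $J=\sup_x (1-K(x,x))$. Let $d_g(x,y)$ be the least $n\ge 0$ for which there are $x_0=x,x_1,\dots,x_n=y$ with $K(x_i,x_{i+1})>0$ for all $0\le i<n$. For probability measures $\mu,\nu$ on $X$ define $$\widetilde W_{2,d_g}(\nu|\mu)^2=\inf_{\gamma}\int\Big(\int d_g(x,y)\,p_x(dy)\Big)^2\mu(dx),$$ where $\gamma$ runs over all couplings with first marginal $\mu$ and second marginal $\nu$, disintegrated as $\gamma(dx\,dy)=p_x(dy)\mu(dx)$. Let $\kappa>0$ and assume the curvature condition $\mathrm{CD}(\kappa,\infty)$: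 $\Gamma_2(f)(x)\ge\kappa\,\Gamma(f)(x)$ for all bounded $f:X\to\mathbb R$ and all $x\in X$. Then for every probability density $f$ with respect to $\pi$ (that is, $f:X\to[0,\infty)$ with $\int f\,d\pi=1$), $$\widetilde W_{2,d_g}(\pi|f\pi)^2\le\frac{\sqrt2\,J}{\kappa^2}\int\Gamma(f)\,d\pi,$$ where the right-hand side may be $+\infty$. -/

import Mathlib

open scoped NNReal ENNReal

noncomputable section

namespace DiscreteMarkov

variable {X : Type*}

/-- `IsWalk K n x y`: there are `x₀ = x, x₁, …, xₙ = y` with `K(xᵢ, xᵢ₊₁) > 0` for all `i < n`. -/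
def IsWalk (K : X → PMF X) (n : ℕ) (x y : X) : Prop :=
  ∃ w : ℕ → X, w 0 = x ∧ w n = y ∧ ∀ i < n, 0 < K (w i) (w (i + 1))

/-- The Markov kernel `K` is irreducible: any state can be reached from any other one. -/
def IsIrreducible (K : X → PMF X) : Prop :=
  ∀ x y, ∃ n, IsWalk K n x y

/-- The graph distance `d_g(x, y)`, the least length of a walk from `x` to `y`
(it is `∞` if there is none, which does not happen for an irreducible kernel). -/
def graphDist (K : X → PMF X) (x y : X) : ℝ≥0∞ :=
  ⨅ (n : ℕ) (_ : IsWalk K n x y), (n : ℝ≥0∞)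

/-- Detailed balance `K(x, y) π(x) = K(y, x) π(y)`. -/
def IsReversible (K : X → PMF X) (π : PMF X) : Prop :=
  ∀ x y, K x y * π x = K y x * π y

/-- `J = sup_x J(x)`, where `J(x) = 1 - K(x, x)`. -/
def maxJumpRate (K : X → PMF X) : ℝ :=
  ⨆ x, (1 - (K x x).toReal)

/-- The generator `L f(x) = ∑_y (f(y) - f(x)) K(x, y)`. -/
def generator (K : X → PMF X) (f : X → ℝ) (x : X) : ℝ :=
  ∑' y, (f y - f x) * (K x y).toReal

/-- The operator `Γ(f, g)(x) = ½ ∑_y (f(y) - f(x)) (g(y) - g(x)) K(x, y)`. -/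
def Gam (K : X → PMF X) (f g : X → ℝ) (x : X) : ℝ :=
  1 / 2 * ∑' y, (f y - f x) * (g y - g x) * (K x y).toReal

/-- The iterated operator `Γ₂(f) = ½ L Γ(f) - Γ(f, L f)`. -/
def Gam₂ (K : X → PMF X) (f : X → ℝ) (x : X) : ℝ :=
  1 / 2 * generator K (Gam K f f) x - Gam K f (generator K f) x

/-- The curvature condition `CD(κ, ∞)`: `Γ₂(f) ≥ κ Γ(f)` at every point, for all bounded `f`.
All the series involved then converge absolutely. On a finite space every function is bounded. -/
def CurvatureDimension (K : X → PMF X) (κ : ℝ) : Prop :=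
  ∀ f : X → ℝ, (∃ C, ∀ x, |f x| ≤ C) → ∀ x, κ * Gam K f f x ≤ Gam₂ K f x

/-- `Γ(f)(x) = ½ ∑_y (f(y) - f(x))² K(x, y)` as an element of `[0, ∞]`, for an arbitrary `f`. -/
def eGam (K : X → PMF X) (f : X → ℝ) (x : X) : ℝ≥0∞ :=
  1 / 2 * ∑' y, ENNReal.ofReal ((f y - f x) ^ 2) * K x y

/-- For a bounded function the two versions of `Γ(f)` agree. -/
theorem eGam_eq_ofReal (K : X → PMF X) (f : X → ℝ) (hf : ∃ C, ∀ x, |f x| ≤ C) (x : X) :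
    eGam K f x = ENNReal.ofReal (Gam K f f x) := by
  obtain ⟨C, hC⟩ := hf
  have hK : Summable fun y => (K x y).toReal := ENNReal.summable_toReal (K x).tsum_coe_ne_top
  have hs : Summable fun y => (f y - f x) * (f y - f x) * (K x y).toReal := by
    refine Summable.of_nonneg_of_le
      (fun y => mul_nonneg (mul_self_nonneg _) ENNReal.toReal_nonneg) (fun y => ?_)
      (hK.mul_left ((2 * C) ^ 2))
    refine mul_le_mul_of_nonneg_right ?_ ENNReal.toReal_nonneg
    have h1 := abs_le.mp (hC x)
    have h2 := abs_le.mp (hC y)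
    nlinarith
  unfold eGam Gam
  rw [ENNReal.ofReal_mul (by norm_num),
    ENNReal.ofReal_tsum_of_nonneg
      (fun y => mul_nonneg (mul_self_nonneg _) ENNReal.toReal_nonneg) hs]
  congr 1
  · rw [ENNReal.ofReal_div_of_pos (by norm_num)]
    simp
  · refine tsum_congr fun y => ?_
    rw [ENNReal.ofReal_mul (mul_self_nonneg _), ENNReal.ofReal_toReal ((K x).apply_ne_top y), sq]

/-- The Dirichlet energy `∫ Γ(f) dπ ∈ [0, ∞]`. -/
def dirichletEnergy (K : X → PMF X) (π : PMF X) (f : X → ℝ) : ℝ≥0∞ :=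
  ∑' x, eGam K f x * π x

/-- The probability measure `f π`, for a probability density `f` with respect to `π`. -/
def withDensity (π : PMF X) (f : X → ℝ≥0) (hf : ∑' x, (f x : ℝ≥0∞) * π x = 1) : PMF X :=
  ⟨fun x => (f x : ℝ≥0∞) * π x, hf ▸ ENNReal.summable.hasSum⟩

/-- `γ` is a coupling of `μ` and `ν`: its first marginal is `μ`, its second marginal is `ν`. -/
def IsCoupling (μ ν : PMF X) (γ : PMF (X × X)) : Prop :=
  γ.map Prod.fst = μ ∧ γ.map Prod.snd = ν

/-- The squared weak transport cost `W̃₂(ν|μ)²`, i.e. the infimum, over all couplings `γ` of `μ` and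
`ν` disintegrated as `γ(dx dy) = p_x(dy) μ(dx)`, of `∫ (∫ d(x, y) p_x(dy))² μ(dx)`. -/
def weakTransportSq (d : X → X → ℝ≥0∞) (ν μ : PMF X) : ℝ≥0∞ :=
  ⨅ (γ : PMF (X × X)) (_ : IsCoupling μ ν γ)
    (p : X → PMF X) (_ : ∀ x y, γ (x, y) = μ x * p x y),
    ∑' x, (∑' y, d x y * p x y) ^ 2 * μ x

end DiscreteMarkov

end

/-! The cost is bounded by duality, and the dual functional by a covariance estimate. Write `d` for
the graph distance, `E = ∫ Γ(f) dπ`, and fix a summable price `φ ≥ 0`. Minimising `(∑ d(x,y) q(y))²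
- ∑ φ(y) q(y)` over sub-probabilities `q` gives a function `Q(x)`; let `m(x)` be the mean
displacement under the minimiser. Comparison with the Dirac mass at `x` gives `Q + φ ≤ -m²`, and
comparison with the minimiser at `y` gives `Q(x) - Q(y) ≤ 2 m(x) d(x,y)` (`exists_infConvolution`).
With `A = ∫ m² dπ`, the dual value `∫ Q f dπ + ∫ φ dπ` is therefore at most `Cov_π(Q, f) - A`, while
the slope bound yields `∫ Γ(Q) dπ ≤ 4 J A` (`energy_le_of_slope`).

Integrating the curvature condition gives `κ ∫ Γ(g) dπ ≤ ∫ (Lg)² dπ`. Since the range of `L` is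
dense among centred functions, this self-improves to the Poincaré inequality with constant `κ`, and
hence to `κ² Cov_π(Q, f)² ≤ ∫ Γ(Q) dπ · E`. So `Cov_π(Q, f) ≤ 2 √(A · J E / κ²) ≤ A + J E / κ²`; the
term `A` cancels and every dual value is at most `J E / κ²`. The factor `√2` of the theorem is
slack.

A uniform dual bound produces a transport plan by quadratic penalisation and compactness
(`exists_kernel_of_dual_bound`). Sub-Markov kernels are used because mass can escape to infinity in
a pointwise limit; nothing is lost in the end, since a sub-Markov image of a probability measure
that covers another one has no mass to spare (`weakTransportSq_le_kernelCost`). -/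

namespace DiscreteMarkov

variable {X : Type*}

/-! ### Compactness and convexity of sub-probabilities and sub-Markov kernels. -/

/-- The sub-probability weights on `X`. -/
def subProb (X : Type*) : Set (X → ℝ) :=
  {q | (∀ y, 0 ≤ q y) ∧ ∑' y, ENNReal.ofReal (q y) ≤ 1}

theorem summable_of_mem_subProb {q : X → ℝ} (hq : q ∈ subProb X) : Summable q := by
  have h : Summable fun y => (ENNReal.ofReal (q y)).toReal :=
    ENNReal.summable_toReal (hq.2.trans_lt ENNReal.one_lt_top).ne
  simpa [ENNReal.toReal_ofReal (hq.1 _)] using h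

theorem tsum_le_one_of_mem_subProb {q : X → ℝ} (hq : q ∈ subProb X) : ∑' y, q y ≤ 1 := by
  have h := hq.2
  rwa [← ENNReal.ofReal_tsum_of_nonneg hq.1 (summable_of_mem_subProb hq),
    ENNReal.ofReal_le_one] at h

theorem le_one_of_mem_subProb {q : X → ℝ} (hq : q ∈ subProb X) (y : X) : q y ≤ 1 :=
  ((summable_of_mem_subProb hq).le_tsum y fun z _ => hq.1 z).trans (tsum_le_one_of_mem_subProb hq)

theorem mem_subProb_of_tsum_le_one {q : X → ℝ} (h0 : ∀ y, 0 ≤ q y) (hs : Summable q)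
    (h1 : ∑' y, q y ≤ 1) : q ∈ subProb X :=
  ⟨h0, by rwa [← ENNReal.ofReal_tsum_of_nonneg h0 hs, ENNReal.ofReal_le_one]⟩

theorem zero_mem_subProb : (0 : X → ℝ) ∈ subProb X :=
  mem_subProb_of_tsum_le_one (fun _ => le_rfl) summable_zero (by simp)

theorem convex_subProb : Convex ℝ (subProb X) := by
  intro p hp q hq a b ha hb hab
  have sp := (summable_of_mem_subProb hp).mul_left a
  have sq := (summable_of_mem_subProb hq).mul_left b
  refine mem_subProb_of_tsum_le_one (fun y => ?_) (sp.add sq) ?_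
  · exact add_nonneg (mul_nonneg ha (hp.1 y)) (mul_nonneg hb (hq.1 y))
  · change ∑' y, (a * p y + b * q y) ≤ 1
    rw [sp.tsum_add sq, tsum_mul_left, tsum_mul_left]
    nlinarith [tsum_le_one_of_mem_subProb hp, tsum_le_one_of_mem_subProb hq]

theorem lowerSemicontinuous_tsum_ofReal {ι E : Type*} [TopologicalSpace E] {g : ι → E → ℝ}
    (hg : ∀ i, Continuous (g i)) :
    LowerSemicontinuous fun e => ∑' i, ENNReal.ofReal (g i e) :=
  lowerSemicontinuous_tsum fun i =>
    (ENNReal.continuous_ofReal.comp (hg i)).lowerSemicontinuous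

/-- For pointwise convergence the total mass is only lower semicontinuous, so the constraint `≤ 1`
is closed whereas `= 1` would not be. What remains is a closed subset of a cube, compact by
Tychonoff. -/
theorem isCompact_subProb : IsCompact (subProb X) := by
  have hc : IsCompact (Set.pi Set.univ fun _ : X => Set.Icc (0 : ℝ) 1) :=
    isCompact_univ_pi fun _ => isCompact_Icc
  have hclosed : IsClosed {q : X → ℝ | ∑' y, ENNReal.ofReal (q y) ≤ 1} :=
    (lowerSemicontinuous_tsum_ofReal fun y => continuous_apply y).isClosed_preimage 1
  refine (hc.inter_right hclosed).of_isClosed_subset ?_ ?_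
  · have : subProb X = (⋂ y, {q : X → ℝ | 0 ≤ q y}) ∩
        {q : X → ℝ | ∑' y, ENNReal.ofReal (q y) ≤ 1} := by
      ext q; simp [subProb]
    rw [this]
    exact (isClosed_iInter fun y => isClosed_le continuous_const (continuous_apply y)).inter hclosed
  · exact fun q hq => ⟨fun y _ => ⟨hq.1 y, le_one_of_mem_subProb hq y⟩, hq.2⟩

/-- The sub-Markov kernels on `X`. -/
def subKernel (X : Type*) : Set (X → X → ℝ) :=
  Set.pi Set.univ fun _ => subProb X

theorem isCompact_subKernel : IsCompact (subKernel X) :=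
  isCompact_univ_pi fun _ => isCompact_subProb

theorem zero_mem_subKernel : (0 : X → X → ℝ) ∈ subKernel X :=
  fun _ _ => zero_mem_subProb

theorem convex_subKernel : Convex ℝ (subKernel X) :=
  convex_pi fun _ _ => convex_subProb

/-! ### Transport cost and image measure of a sub-Markov kernel. -/

/-- The quadratic weak transport cost of a sub-Markov kernel with respect to `μ`. -/
noncomputable def kernelCost (d : X → X → ℝ) (μ : X → ℝ) (p : X → X → ℝ) : ℝ≥0∞ :=
  ∑' x, ENNReal.ofReal (μ x) * (∑' y, ENNReal.ofReal (d x y * p x y)) ^ 2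

/-- The image of `μ` under a kernel. -/
noncomputable def push (μ : X → ℝ) (p : X → X → ℝ) (y : X) : ℝ :=
  ∑' x, μ x * p x y

theorem lowerSemicontinuous_sq {E : Type*} [TopologicalSpace E] {g : E → ℝ≥0∞}
    (hg : LowerSemicontinuous g) : LowerSemicontinuous fun e => g e ^ 2 :=
  (ENNReal.continuous_pow 2).comp_lowerSemicontinuous hg (pow_left_mono 2)

theorem lowerSemicontinuous_kernelCost (d : X → X → ℝ) (μ : X → ℝ) :
    LowerSemicontinuous (kernelCost d μ) := by
  refine lowerSemicontinuous_tsum fun x => ?_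
  refine (ENNReal.continuous_const_mul ENNReal.ofReal_ne_top).comp_lowerSemicontinuous
    (lowerSemicontinuous_sq (lowerSemicontinuous_tsum_ofReal fun y => ?_))
    (fun a b hab => mul_le_mul_right hab _)
  fun_prop

theorem ofReal_combo_sq {a b : ℝ} (ha : 0 ≤ a) (hb : 0 ≤ b) (hab : a + b = 1) (s t : ℝ≥0∞) :
    (ENNReal.ofReal a * s + ENNReal.ofReal b * t) ^ 2 ≤
      ENNReal.ofReal a * s ^ 2 + ENNReal.ofReal b * t ^ 2 := by
  have := ENNReal.rpow_arith_mean_le_arith_mean2_rpow (ENNReal.ofReal a) (ENNReal.ofReal b) s t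
    (by rw [← ENNReal.ofReal_add ha hb, hab, ENNReal.ofReal_one]) (p := 2) (by norm_num)
  simpa using this

theorem kernelCost_combo_le {d : X → X → ℝ} (hd : ∀ x y, 0 ≤ d x y) (μ : X → ℝ)
    {p q : X → X → ℝ} (hp : p ∈ subKernel X) (hq : q ∈ subKernel X)
    {a b : ℝ} (ha : 0 ≤ a) (hb : 0 ≤ b) (hab : a + b = 1) :
    kernelCost d μ (a • p + b • q) ≤
      ENNReal.ofReal a * kernelCost d μ p + ENNReal.ofReal b * kernelCost d μ q := by
  unfold kernelCost
  rw [← ENNReal.tsum_mul_left, ← ENNReal.tsum_mul_left, ← ENNReal.tsum_add]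
  refine ENNReal.tsum_le_tsum fun x => ?_
  have h : ∑' y, ENNReal.ofReal (d x y * (a • p + b • q) x y) =
      ENNReal.ofReal a * ∑' y, ENNReal.ofReal (d x y * p x y) +
        ENNReal.ofReal b * ∑' y, ENNReal.ofReal (d x y * q x y) := by
    rw [← ENNReal.tsum_mul_left, ← ENNReal.tsum_mul_left, ← ENNReal.tsum_add]
    refine tsum_congr fun y => ?_
    have h1 : 0 ≤ d x y * p x y := mul_nonneg (hd x y) ((hp x trivial).1 y)
    have h2 : 0 ≤ d x y * q x y := mul_nonneg (hd x y) ((hq x trivial).1 y)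
    rw [← ENNReal.ofReal_mul ha, ← ENNReal.ofReal_mul hb,
      ← ENNReal.ofReal_add (mul_nonneg ha h1) (mul_nonneg hb h2)]
    congr 1
    simp only [Pi.add_apply, Pi.smul_apply, smul_eq_mul]
    ring
  rw [h]
  calc _ ≤ ENNReal.ofReal (μ x) * (ENNReal.ofReal a * (∑' y, ENNReal.ofReal (d x y * p x y)) ^ 2 +
        ENNReal.ofReal b * (∑' y, ENNReal.ofReal (d x y * q x y)) ^ 2) :=
        mul_le_mul_right (ofReal_combo_sq ha hb hab _ _) _
    _ = _ := by ring

theorem push_nonneg {μ : X → ℝ} (h0 : ∀ x, 0 ≤ μ x) {p : X → X → ℝ} (hp : p ∈ subKernel X)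
    (y : X) : 0 ≤ push μ p y :=
  tsum_nonneg fun x => mul_nonneg (h0 x) ((hp x trivial).1 y)

section push

variable {μ : X → ℝ} (h0 : ∀ x, 0 ≤ μ x) (hs : Summable μ)
include h0 hs

theorem summable_mul_kernel {p : X → X → ℝ} (hp : p ∈ subKernel X) (y : X) :
    Summable fun x => μ x * p x y :=
  hs.of_nonneg_of_le (fun x => mul_nonneg (h0 x) ((hp x trivial).1 y))
    fun x => mul_le_of_le_one_right (h0 x) (le_one_of_mem_subProb (hp x trivial) y)

theorem summable_prod_kernel {p : X → X → ℝ} (hp : p ∈ subKernel X) :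
    Summable fun z : X × X => μ z.1 * p z.1 z.2 := by
  refine (summable_prod_of_nonneg
    (fun z => mul_nonneg (h0 z.1) ((hp z.1 trivial).1 z.2))).2 ⟨fun x => ?_, ?_⟩
  · exact (summable_of_mem_subProb (hp x trivial)).mul_left (μ x)
  · refine hs.of_nonneg_of_le
      (fun x => tsum_nonneg fun y => mul_nonneg (h0 x) ((hp x trivial).1 y)) fun x => ?_
    change ∑' y, μ x * p x y ≤ μ x
    rw [tsum_mul_left]
    exact mul_le_of_le_one_right (h0 x) (tsum_le_one_of_mem_subProb (hp x trivial))

theorem summable_push {p : X → X → ℝ} (hp : p ∈ subKernel X) : Summable (push μ p) :=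
  (summable_prod_kernel h0 hs hp).prod_symm.prod

theorem tsum_push_mul {p : X → X → ℝ} (hp : p ∈ subKernel X) {φ : X → ℝ} {C : ℝ}
    (hφ : ∀ y, |φ y| ≤ C) :
    ∑' y, φ y * push μ p y = ∑' x, μ x * ∑' y, φ y * p x y := by
  have hsum : Summable fun z : X × X => φ z.2 * (μ z.1 * p z.1 z.2) := by
    refine Summable.of_norm_bounded ((summable_prod_kernel h0 hs hp).mul_left C) fun z => ?_
    have := mul_nonneg (h0 z.1) ((hp z.1 trivial).1 z.2)
    rw [Real.norm_eq_abs, abs_mul, abs_of_nonneg this]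
    exact mul_le_mul_of_nonneg_right (hφ _) this
  simp only [push, ← tsum_mul_left]
  rw [Summable.tsum_comm (f := fun x y => φ y * (μ x * p x y)) hsum]
  exact tsum_congr fun x => tsum_congr fun y => by ring

theorem push_combo {p q : X → X → ℝ} (hp : p ∈ subKernel X) (hq : q ∈ subKernel X) (a b : ℝ)
    (y : X) : push μ (a • p + b • q) y = a * push μ p y + b * push μ q y := by
  unfold push
  rw [← tsum_mul_left, ← tsum_mul_left, ← ((summable_mul_kernel h0 hs hp y).mul_left a).tsum_add
    ((summable_mul_kernel h0 hs hq y).mul_left b)]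
  refine tsum_congr fun x => ?_
  simp only [Pi.add_apply, Pi.smul_apply, smul_eq_mul]
  ring

/-- Kernel entries are at most `1`, so the series is dominated by `μ` uniformly in the kernel. -/
theorem continuousOn_push (y : X) : ContinuousOn (fun p => push μ p y) (subKernel X) := by
  refine continuousOn_tsum (u := μ) (fun x => by fun_prop) hs fun x p hp => ?_
  rw [Real.norm_eq_abs, abs_of_nonneg (mul_nonneg (h0 x) ((hp x trivial).1 y))]
  exact mul_le_of_le_one_right (h0 x) (le_one_of_mem_subProb (hp x trivial) y)

end push

/-! ### Duality by quadratic penalisation. -/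

/-- A one-sided Taylor expansion of the squared positive part, whose derivative at `a` is `2 * max a
0`; it replaces differentiation of the penalty under the sum. -/
theorem max_sub_sq_le (a b t : ℝ) :
    max (a - t * b) 0 ^ 2 ≤ max a 0 ^ 2 - 2 * t * (max a 0 * b) + t ^ 2 * b ^ 2 := by
  have h1 : |max (a - t * b) 0| ≤ |max a 0 - t * b| ∨ max (a - t * b) 0 = 0 := by
    rcases le_total (a - t * b) 0 with h | h
    · right; exact max_eq_right h
    · left
      rw [max_eq_left h, abs_of_nonneg h]
      exact (sub_le_sub_right (le_max_left a 0) _).trans (le_abs_self _)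
  have h2 : max (a - t * b) 0 ^ 2 ≤ (max a 0 - t * b) ^ 2 := by
    rcases h1 with h | h
    · exact sq_le_sq.2 h
    · rw [h]; simpa using sq_nonneg (max a 0 - t * b)
  linarith [h2, show (max a 0 - t * b) ^ 2 =
    max a 0 ^ 2 - 2 * t * (max a 0 * b) + t ^ 2 * b ^ 2 by ring]

theorem nonneg_of_forall_quadratic {A D : ℝ}
    (h : ∀ t : ℝ, 0 < t → t ≤ 1 → 0 ≤ t * A + t ^ 2 * D) : 0 ≤ A := by
  by_contra! hA
  have hD : 0 < |D| + 1 := by positivity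
  -- Small enough that `t * |D| ≤ -A / 2`, so the linear term dominates.
  set t := min 1 (-A / (2 * (|D| + 1)))
  have ht0 : 0 < t := lt_min one_pos (div_pos (by linarith) (by linarith))
  have h1 := h t ht0 (min_le_left _ _)
  have h2 : t * (2 * (|D| + 1)) ≤ -A := (le_div_iff₀ (by linarith)).1 (min_le_right _ _)
  have h3 : 0 ≤ A + t * D := by
    have : 0 ≤ t * (A + t * D) := by linarith [h1, show t * (A + t * D) = t * A + t ^ 2 * D by ring]
    exact nonneg_of_mul_nonneg_right this ht0
  nlinarith [le_abs_self D, abs_nonneg D]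

section duality

variable {d : X → X → ℝ} (hd : ∀ x y, 0 ≤ d x y)
  {μ π : X → ℝ} (hμ0 : ∀ x, 0 ≤ μ x) (hμ : Summable μ) (hπ0 : ∀ x, 0 ≤ π x) (hπ : Summable π)

include hμ0 hπ0 hπ

theorem summable_penalty {p : X → X → ℝ} (hp : p ∈ subKernel X) :
    Summable fun y => max (π y - push μ p y) 0 ^ 2 := by
  have h : ∀ y, max (π y - push μ p y) 0 ≤ π y := fun y =>
    max_le (by linarith [push_nonneg hμ0 hp y]) (hπ0 y)
  refine (hπ.mul_left (∑' z, π z)).of_nonneg_of_le (fun y => sq_nonneg _) fun y => ?_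
  have h2 := hπ.le_tsum y fun z _ => hπ0 z
  rw [sq]
  exact mul_le_mul ((h y).trans h2) (h y) (le_max_right _ _) ((hπ0 y).trans h2)

include hμ

/-- The direct method: the cost is lower semicontinuous, and the penalty, which charges only the
shortfall below `π`, is continuous by domination, both on a compact set. -/
theorem exists_penalty_minimizer (N : ℝ) :
    ∃ p ∈ subKernel X, ∀ p' ∈ subKernel X,
      kernelCost d μ p + ENNReal.ofReal (N * ∑' y, max (π y - push μ p y) 0 ^ 2) ≤
        kernelCost d μ p' + ENNReal.ofReal (N * ∑' y, max (π y - push μ p' y) 0 ^ 2) := by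
  have hcont : ContinuousOn (fun p => ∑' y, max (π y - push μ p y) 0 ^ 2) (subKernel X) := by
    refine continuousOn_tsum (u := fun y => (∑' z, π z) * π y) (fun y => ?_) (hπ.mul_left _)
      fun y p hp => ?_
    · exact ContinuousOn.pow (ContinuousOn.sup
        (continuousOn_const.sub (continuousOn_push hμ0 hμ y)) continuousOn_const) 2
    · have h : max (π y - push μ p y) 0 ≤ π y :=
        max_le (by linarith [push_nonneg hμ0 hp y]) (hπ0 y)
      have h2 := hπ.le_tsum y fun z _ => hπ0 z
      rw [Real.norm_eq_abs, abs_of_nonneg (sq_nonneg _), sq]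
      exact mul_le_mul (h.trans h2) h (le_max_right _ _) ((hπ0 y).trans h2)
  have hlsc : LowerSemicontinuousOn (fun p => kernelCost d μ p +
      ENNReal.ofReal (N * ∑' y, max (π y - push μ p y) 0 ^ 2)) (subKernel X) := by
    refine ((lowerSemicontinuous_kernelCost d μ).lowerSemicontinuousOn _).add ?_
    exact (ENNReal.continuous_ofReal.comp_continuousOn
      (continuousOn_const.mul hcont)).lowerSemicontinuousOn
  obtain ⟨p, hp, hmin⟩ := hlsc.exists_isMinOn
    ⟨0, zero_mem_subKernel⟩ isCompact_subKernel
  exact ⟨p, hp, fun p' hp' => hmin hp'⟩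

include hd

/-- First-order optimality along the segment from `p` to `q`. The cost is convex, so its increment
is at most linear in `t`; the penalty is expanded to second order. The derivative of the penalty
supplies the multiplier `2 N (π - push μ p)₊`. -/
theorem penalty_minimizer_variational {N : ℝ} (hN : 0 ≤ N) {p : X → X → ℝ} (hp : p ∈ subKernel X)
    (hmin : ∀ p' ∈ subKernel X,
      kernelCost d μ p + ENNReal.ofReal (N * ∑' y, max (π y - push μ p y) 0 ^ 2) ≤
        kernelCost d μ p' + ENNReal.ofReal (N * ∑' y, max (π y - push μ p' y) 0 ^ 2))
    {q : X → X → ℝ} (hq : q ∈ subKernel X) (hqc : kernelCost d μ q ≠ ⊤) :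
    kernelCost d μ p ≠ ⊤ ∧ (kernelCost d μ p).toReal +
      ∑' y, 2 * N * max (π y - push μ p y) 0 * (push μ q y - push μ p y) ≤
        (kernelCost d μ q).toReal := by
  have hpc : kernelCost d μ p ≠ ⊤ := by
    refine ne_top_of_le_ne_top ?_ (le_self_add.trans (hmin q hq))
    exact ENNReal.add_ne_top.2 ⟨hqc, ENNReal.ofReal_ne_top⟩
  refine ⟨hpc, ?_⟩
  have sp := summable_push hμ0 hμ hp
  have sq := summable_push hμ0 hμ hq
  set a : X → ℝ := fun y => π y - push μ p y with ha
  set b : X → ℝ := fun y => push μ q y - push μ p y with hb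
  have sa : Summable a := hπ.sub sp
  have sb : Summable b := sq.sub sp
  have sP : Summable fun y => max (a y) 0 ^ 2 := summable_penalty hμ0 hπ0 hπ hp
  have hbd : ∀ y, |b y| ≤ ∑' z, |b z| := fun y => sb.abs.le_tsum y fun z _ => abs_nonneg _
  have sab : Summable fun y => max (a y) 0 * b y := by
    refine Summable.of_norm_bounded (sa.abs.mul_left (∑' z, |b z|)) fun y => ?_
    rw [Real.norm_eq_abs, abs_mul, mul_comm]
    refine mul_le_mul (hbd y) ?_ (abs_nonneg _) ((abs_nonneg _).trans (hbd y))
    rw [abs_of_nonneg (le_max_right _ _)]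
    exact max_le (le_abs_self _) (abs_nonneg _)
  have sbb : Summable fun y => b y ^ 2 := by
    refine (sb.abs.mul_left (∑' z, |b z|)).of_nonneg_of_le (fun y => sq_nonneg _) fun y => ?_
    rw [← sq_abs, pow_two]
    exact mul_le_mul_of_nonneg_right (hbd y) (abs_nonneg _)
  have key : 0 ≤ (kernelCost d μ q).toReal - (kernelCost d μ p).toReal -
      2 * N * ∑' y, max (a y) 0 * b y := by
    refine nonneg_of_forall_quadratic (D := N * ∑' y, b y ^ 2) fun t ht0 ht1 => ?_
    have ht1' : 0 ≤ 1 - t := by linarith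
    set r := (1 - t) • p + t • q with hr
    have hrK : r ∈ subKernel X := convex_subKernel hp hq ht1' ht0.le (by ring)
    have hc : kernelCost d μ r ≤ ENNReal.ofReal
        ((1 - t) * (kernelCost d μ p).toReal + t * (kernelCost d μ q).toReal) := by
      refine (kernelCost_combo_le hd μ hp hq ht1' ht0.le (by ring)).trans_eq ?_
      rw [ENNReal.ofReal_add (mul_nonneg ht1' ENNReal.toReal_nonneg)
        (mul_nonneg ht0.le ENNReal.toReal_nonneg), ENNReal.ofReal_mul ht1',
        ENNReal.ofReal_mul ht0.le, ENNReal.ofReal_toReal hpc, ENNReal.ofReal_toReal hqc]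
    have hpen : ∑' y, max (π y - push μ r y) 0 ^ 2 ≤
        ∑' y, max (a y) 0 ^ 2 - 2 * t * ∑' y, max (a y) 0 * b y + t ^ 2 * ∑' y, b y ^ 2 := by
      rw [← tsum_mul_left, ← tsum_mul_left, ← sP.tsum_sub (sab.mul_left _),
        ← (sP.sub (sab.mul_left _)).tsum_add (sbb.mul_left _)]
      refine (summable_penalty hμ0 hπ0 hπ hrK).tsum_le_tsum (fun y => ?_)
        ((sP.sub (sab.mul_left _)).add (sbb.mul_left _))
      have : π y - push μ r y = a y - t * b y := by
        rw [hr, push_combo hμ0 hμ hp hq]; simp only [ha, hb]; ring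
      rw [this]
      exact max_sub_sq_le _ _ _
    have hP0 : 0 ≤ ∑' y, max (a y) 0 ^ 2 := tsum_nonneg fun y => sq_nonneg _
    have hR0 : 0 ≤ ∑' y, max (π y - push μ r y) 0 ^ 2 := tsum_nonneg fun y => sq_nonneg _
    have h1 := (hmin r hrK).trans (add_le_add_left hc _)
    rw [← ENNReal.ofReal_toReal hpc, ← ENNReal.ofReal_add ENNReal.toReal_nonneg
      (mul_nonneg hN hP0), ENNReal.toReal_ofReal ENNReal.toReal_nonneg,
      ← ENNReal.ofReal_add (add_nonneg (mul_nonneg ht1' ENNReal.toReal_nonneg)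
      (mul_nonneg ht0.le ENNReal.toReal_nonneg)) (mul_nonneg hN hR0),
      ENNReal.ofReal_le_ofReal_iff (by positivity)] at h1
    have h2 := mul_le_mul_of_nonneg_left hpen hN
    linarith
  have : ∑' y, 2 * N * max (a y) 0 * b y = 2 * N * ∑' y, max (a y) 0 * b y := by
    rw [← tsum_mul_left]; exact tsum_congr fun y => by ring
  rw [this]
  linarith

/-- A duality theorem for the quadratic weak transport cost: a bound for the dual problem yields a
sub-Markov kernel of controlled cost that covers the target measure. -/
theorem exists_kernel_of_dual_bound [Countable X] {B : ℝ}
    (h : ∀ φ : X → ℝ, (∀ y, 0 ≤ φ y) → Summable φ → ∃ q ∈ subKernel X,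
      kernelCost d μ q ≠ ⊤ ∧
        (kernelCost d μ q).toReal + ∑' y, φ y * (π y - push μ q y) ≤ B) :
    ∃ p ∈ subKernel X, kernelCost d μ p ≤ ENNReal.ofReal B ∧ ∀ y, π y ≤ push μ p y := by
  have step : ∀ n : ℕ, ∃ p ∈ subKernel X, kernelCost d μ p ≤ ENNReal.ofReal B ∧
      ∀ y, π y - √(B / (2 * (n + 1))) ≤ push μ p y := by
    intro n
    have hN : (0 : ℝ) < n + 1 := by positivity
    obtain ⟨p, hp, hmin⟩ := exists_penalty_minimizer (d := d) hμ0 hμ hπ0 hπ (n + 1 : ℝ)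
    have sp := summable_push hμ0 hμ hp
    have sP := summable_penalty hμ0 hπ0 hπ hp
    -- The multiplier of the penalised problem is the price fed into the dual bound.
    set φ : X → ℝ := fun y => 2 * (n + 1 : ℝ) * max (π y - push μ p y) 0 with hφ
    have hφ0 : ∀ y, 0 ≤ φ y := fun y => mul_nonneg (by positivity) (le_max_right _ _)
    have hφs : Summable φ := by
      refine ((hπ.mul_left (2 * (n + 1 : ℝ))).of_nonneg_of_le hφ0 fun y => ?_)
      exact mul_le_mul_of_nonneg_left
        (max_le (by linarith [push_nonneg hμ0 hp y]) (hπ0 y)) (by positivity)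
    obtain ⟨q, hq, hqc, hqB⟩ := h φ hφ0 hφs
    obtain ⟨hpc, hvar⟩ := penalty_minimizer_variational hd hμ0 hμ hπ0 hπ hN.le hp hmin hq hqc
    have hφb : ∀ y, φ y ≤ ∑' z, φ z := fun y => hφs.le_tsum y fun z _ => hφ0 z
    have smul : ∀ g : X → ℝ, Summable g → Summable fun y => φ y * g y := fun g hg => by
      refine Summable.of_norm_bounded (hg.abs.mul_left (∑' z, φ z)) fun y => ?_
      rw [Real.norm_eq_abs, abs_mul, abs_of_nonneg (hφ0 y)]
      exact mul_le_mul_of_nonneg_right (hφb y) (abs_nonneg _)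
    have sq := summable_push hμ0 hμ hq
    have hsum : (kernelCost d μ p).toReal + ∑' y, φ y * (π y - push μ p y) ≤ B := by
      have e : ∑' y, φ y * (π y - push μ p y) =
          ∑' y, φ y * (π y - push μ q y) + ∑' y, φ y * (push μ q y - push μ p y) := by
        rw [← (smul _ (hπ.sub sq)).tsum_add (smul _ (sq.sub sp))]
        exact tsum_congr fun y => by ring
      rw [e]; linarith
    -- Complementary slackness: the price vanishes where demand is met, so the bound `B` controls
    -- the cost and the squared shortfall simultaneously.
    have hpos : ∀ y, φ y * (π y - push μ p y) =
        2 * (n + 1 : ℝ) * max (π y - push μ p y) 0 ^ 2 := fun y => by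
      rcases le_total (π y - push μ p y) 0 with h | h
      · simp [hφ, max_eq_right h]
      · simp only [hφ, max_eq_left h]; ring
    have hterm : ∀ y, 0 ≤ φ y * (π y - push μ p y) := fun y => by rw [hpos]; positivity
    refine ⟨p, hp, ?_, fun y => ?_⟩
    · rw [← ENNReal.ofReal_toReal hpc]
      exact ENNReal.ofReal_le_ofReal (by
        have : 0 ≤ ∑' y, φ y * (π y - push μ p y) := tsum_nonneg hterm
        linarith)
    · have h1 := (smul _ (hπ.sub sp)).le_tsum y fun z _ => hterm z
      have h2 : 2 * (n + 1 : ℝ) * max (π y - push μ p y) 0 ^ 2 ≤ B := by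
        rw [← hpos]; linarith [ENNReal.toReal_nonneg (a := kernelCost d μ p)]
      have h3 : max (π y - push μ p y) 0 ≤ √(B / (2 * (n + 1))) := by
        refine Real.le_sqrt_of_sq_le ?_
        rw [le_div_iff₀ (by positivity)]; linarith
      linarith [le_max_left (π y - push μ p y) 0]
  choose p hp hc hpush using step
  -- Countability of `X` makes the product topology first countable, so compactness yields a
  -- convergent subsequence as the penalty weight tends to infinity.
  obtain ⟨q, hq, s, hs, hlim⟩ := isCompact_subKernel.tendsto_subseq hp
  refine ⟨q, hq, ?_, fun y => ?_⟩
  · exact ((lowerSemicontinuous_kernelCost d μ).isClosed_preimage (ENNReal.ofReal B)).mem_of_tendsto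
      hlim (Filter.Eventually.of_forall fun n => hc (s n))
  · have h1 : Filter.Tendsto (fun n => push μ (p (s n)) y) Filter.atTop (nhds (push μ q y)) :=
      (continuousOn_push hμ0 hμ y q hq).tendsto.comp
        (tendsto_nhdsWithin_iff.2 ⟨hlim, Filter.Eventually.of_forall fun n => hp (s n)⟩)
    have h2 : Filter.Tendsto (fun n : ℕ => π y - √(B / (2 * ((s n : ℕ) + 1 : ℝ)))) Filter.atTop
        (nhds (π y - √0)) := by
      refine tendsto_const_nhds.sub ((Real.continuous_sqrt.tendsto 0).comp ?_)
      have h3 : Filter.Tendsto (fun n : ℕ => 2 * ((n : ℝ) + 1)) Filter.atTop Filter.atTop :=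
        (Filter.tendsto_atTop_add_const_right _ _ tendsto_natCast_atTop_atTop).const_mul_atTop
          (by norm_num)
      exact (h3.const_div_atTop B).comp hs.tendsto_atTop
    rw [Real.sqrt_zero, sub_zero] at h2
    exact le_of_tendsto_of_tendsto' h2 h1 fun n => hpush (s n) y

end duality

/-! ### The pointwise dual problem and its inf-convolution. -/

theorem summable_mul_subProb {φ : X → ℝ} (hφ0 : ∀ y, 0 ≤ φ y) (hφ : Summable φ) {q : X → ℝ}
    (hq : q ∈ subProb X) : Summable fun y => φ y * q y :=
  hφ.of_nonneg_of_le (fun y => mul_nonneg (hφ0 y) (hq.1 y))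
    fun y => mul_le_of_le_one_right (hφ0 y) (le_one_of_mem_subProb hq y)

theorem tsum_mul_subProb_le {φ : X → ℝ} (hφ0 : ∀ y, 0 ≤ φ y) (hφ : Summable φ) {q : X → ℝ}
    (hq : q ∈ subProb X) : ∑' y, φ y * q y ≤ ∑' y, φ y :=
  (summable_mul_subProb hφ0 hφ hq).tsum_le_tsum
    (fun y => mul_le_of_le_one_right (hφ0 y) (le_one_of_mem_subProb hq y)) hφ

/-- Adding the constant `∑ φ` turns `-∑ φ q` into `∑ φ (1 - q)`, a series of nonnegative terms. The
functional becomes `[0, ∞]`-valued and lower semicontinuous even for unbounded `c`, and finiteness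
at the minimiser gives summability. -/
theorem exists_subProb_minimizer {c : X → ℝ} (hc : ∀ y, 0 ≤ c y) {φ : X → ℝ}
    (hφ0 : ∀ y, 0 ≤ φ y) (hφ : Summable φ) :
    ∃ q ∈ subProb X, (Summable fun y => c y * q y) ∧
      ∀ q' ∈ subProb X, (Summable fun y => c y * q' y) →
        (∑' y, c y * q y) ^ 2 - ∑' y, φ y * q y ≤ (∑' y, c y * q' y) ^ 2 - ∑' y, φ y * q' y := by
  set G : (X → ℝ) → ℝ≥0∞ := fun q =>
    (∑' y, ENNReal.ofReal (c y * q y)) ^ 2 + ∑' y, ENNReal.ofReal (φ y * (1 - q y)) with hG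
  have hlsc : LowerSemicontinuous G :=
    (lowerSemicontinuous_sq (lowerSemicontinuous_tsum_ofReal fun y => by fun_prop)).add
      (lowerSemicontinuous_tsum_ofReal fun y => by fun_prop)
  have hval : ∀ q ∈ subProb X, (Summable fun y => c y * q y) →
      G q = ENNReal.ofReal ((∑' y, c y * q y) ^ 2 - ∑' y, φ y * q y + ∑' y, φ y) ∧
        0 ≤ (∑' y, c y * q y) ^ 2 - ∑' y, φ y * q y + ∑' y, φ y := by
    intro q hq hs
    have h0 : ∀ y, 0 ≤ c y * q y := fun y => mul_nonneg (hc y) (hq.1 y)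
    have h1 : ∀ y, 0 ≤ φ y * (1 - q y) := fun y =>
      mul_nonneg (hφ0 y) (sub_nonneg.2 (le_one_of_mem_subProb hq y))
    have s1 := summable_mul_subProb hφ0 hφ hq
    have e : (fun y => φ y * (1 - q y)) = fun y => φ y - φ y * q y := by ext y; ring
    have s2 : Summable fun y => φ y * (1 - q y) := e ▸ hφ.sub s1
    have e2 : ∑' y, φ y * (1 - q y) = ∑' y, φ y - ∑' y, φ y * q y := by rw [e, hφ.tsum_sub s1]
    have h2 := tsum_mul_subProb_le hφ0 hφ hq
    refine ⟨?_, by nlinarith [sq_nonneg (∑' y, c y * q y)]⟩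
    rw [hG]
    beta_reduce
    rw [← ENNReal.ofReal_tsum_of_nonneg h0 hs, ← ENNReal.ofReal_tsum_of_nonneg h1 s2,
      ← ENNReal.ofReal_pow (tsum_nonneg h0), ← ENNReal.ofReal_add (sq_nonneg _) (tsum_nonneg h1), e2]
    congr 1
    ring
  obtain ⟨q, hq, hmin⟩ := (hlsc.lowerSemicontinuousOn (subProb X)).exists_isMinOn
    ⟨0, zero_mem_subProb⟩ isCompact_subProb
  have hfin : G q ≠ ⊤ := by
    refine ne_top_of_le_ne_top ?_ (hmin zero_mem_subProb)
    rw [(hval 0 zero_mem_subProb (by simp)).1]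
    exact ENNReal.ofReal_ne_top
  have hs : Summable fun y => c y * q y := by
    have h1 : ∑' y, ENNReal.ofReal (c y * q y) ≠ ⊤ := by
      intro h
      exact hfin (by simp [hG, h])
    have := ENNReal.summable_toReal h1
    simpa [ENNReal.toReal_ofReal (mul_nonneg (hc _) (hq.1 _))] using this
  refine ⟨q, hq, hs, fun q' hq' hs' => ?_⟩
  have h := hmin hq'
  simp only [Set.mem_ofPred_eq] at h
  rw [(hval q hq hs).1, (hval q' hq' hs').1, ENNReal.ofReal_le_ofReal_iff (hval q' hq' hs').2] at h
  linarith

theorem subProb_minimizer_variational {c : X → ℝ} {φ : X → ℝ} (hφ0 : ∀ y, 0 ≤ φ y)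
    (hφ : Summable φ) {q : X → ℝ} (hq : q ∈ subProb X) (hs : Summable fun y => c y * q y)
    (hmin : ∀ q' ∈ subProb X, (Summable fun y => c y * q' y) →
      (∑' y, c y * q y) ^ 2 - ∑' y, φ y * q y ≤ (∑' y, c y * q' y) ^ 2 - ∑' y, φ y * q' y)
    {r : X → ℝ} (hr : r ∈ subProb X) (hrs : Summable fun y => c y * r y) :
    0 ≤ 2 * (∑' y, c y * q y) * (∑' y, c y * r y - ∑' y, c y * q y) +
      ∑' y, φ y * q y - ∑' y, φ y * r y := by
  refine nonneg_of_forall_quadratic (D := (∑' y, c y * r y - ∑' y, c y * q y) ^ 2)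
    fun t ht0 ht1 => ?_
  have combo : ∀ g : X → ℝ, (Summable fun y => g y * q y) → (Summable fun y => g y * r y) →
      HasSum (fun y => g y * ((1 - t) • q + t • r) y)
        ((1 - t) * ∑' y, g y * q y + t * ∑' y, g y * r y) := fun g h1 h2 => by
    refine ((h1.hasSum.mul_left (1 - t)).add (h2.hasSum.mul_left t)).congr_fun fun y => ?_
    change g y * ((1 - t) * q y + t * r y) = _
    ring
  have hc := combo c hs hrs
  have hp := combo φ (summable_mul_subProb hφ0 hφ hq) (summable_mul_subProb hφ0 hφ hr)
  have h := hmin _ (convex_subProb hq hr (by linarith : 0 ≤ 1 - t) ht0.le (by ring)) hc.summable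
  rw [hc.tsum_eq, hp.tsum_eq] at h
  nlinarith [h]

/-- The inf-convolution of `-φ` associated with the quadratic weak transport cost: `Q x` is the
minimum over sub-probabilities `q` of `(∑ d(x, y) q(y))² - ∑ φ(y) q(y)`, it is attained at a kernel
`q`, and `m x = ∑ d(x, y) q_x(y)` controls the descending slope of `Q`. -/
theorem exists_infConvolution {d : X → X → ℝ} (hd : ∀ x y, 0 ≤ d x y) (hdx : ∀ x, d x x = 0)
    (htri : ∀ x y z, d x z ≤ d x y + d y z) {φ : X → ℝ} (hφ0 : ∀ y, 0 ≤ φ y) (hφ : Summable φ) :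
    ∃ q ∈ subKernel X, ∃ m Q : X → ℝ, (∀ x, 0 ≤ m x) ∧ (∀ x, m x ^ 2 ≤ ∑' y, φ y) ∧
      (∀ x, ∑' y, ENNReal.ofReal (d x y * q x y) = ENNReal.ofReal (m x)) ∧
      (∀ x, Q x = m x ^ 2 - ∑' y, φ y * q x y) ∧ (∀ x, |Q x| ≤ ∑' y, φ y) ∧
      (∀ x, Q x + φ x ≤ -m x ^ 2) ∧ ∀ x y, Q x - Q y ≤ 2 * m x * d x y := by
  classical
  choose q hq hs hmin using fun x => exists_subProb_minimizer (hd x) hφ0 hφ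
  have h0 : ∀ x y, 0 ≤ d x y * q x y := fun x y => mul_nonneg (hd x y) ((hq x).1 y)
  have hm0 : ∀ x, 0 ≤ ∑' y, d x y * q x y := fun x => tsum_nonneg (h0 x)
  have hs0 : ∀ x, 0 ≤ ∑' y, φ y * q x y := fun x =>
    tsum_nonneg fun y => mul_nonneg (hφ0 y) ((hq x).1 y)
  have hs1 := fun x => tsum_mul_subProb_le hφ0 hφ (hq x)
  have hvar := fun x => fun r hr hrs =>
    subProb_minimizer_variational (r := r) hφ0 hφ (hq x) (hs x) (hmin x) hr hrs
  -- The zero sub-probability as competitor; this bounds `m` and `Q`.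
  have hzero : ∀ x, 2 * (∑' y, d x y * q x y) ^ 2 ≤ ∑' y, φ y * q x y := fun x => by
    have := hvar x 0 zero_mem_subProb (by simp)
    simp only [Pi.zero_apply, mul_zero, tsum_zero, zero_sub, sub_zero] at this
    linarith [sq (∑' y, d x y * q x y)]
  refine ⟨q, fun x _ => hq x, fun x => ∑' y, d x y * q x y,
    fun x => (∑' y, d x y * q x y) ^ 2 - ∑' y, φ y * q x y, hm0, fun x => ?_, fun x => ?_,
    fun x => rfl, fun x => ?_, fun x => ?_, fun x y => ?_⟩
  · nlinarith [hzero x, hs1 x, sq_nonneg (∑' y, d x y * q x y)]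
  · rw [← ENNReal.ofReal_tsum_of_nonneg (h0 x) (hs x)]
  · rw [abs_le]
    constructor <;> nlinarith [hzero x, hs1 x, hs0 x, sq_nonneg (∑' y, d x y * q x y)]
  · have e : ∀ g : X → ℝ, HasSum (fun y => g y * (Pi.single x 1 : X → ℝ) y) (g x) := fun g => by
      convert hasSum_ite_eq x (g x) using 2 with y
      rcases eq_or_ne y x with rfl | h
      · simp
      · simp [h]
    have hδ : (Pi.single x 1 : X → ℝ) ∈ subProb X := by
      have h1 := e fun _ => 1
      simp only [one_mul] at h1
      refine mem_subProb_of_tsum_le_one (fun y => ?_) h1.summable h1.tsum_eq.le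
      exact (Pi.single_nonneg.2 zero_le_one : (0 : X → ℝ) ≤ Pi.single x 1) y
    -- The Dirac mass at `x` transports nothing, and the first-order inequality, rather than mere
    -- minimality, produces the gain `-m x ^ 2`.
    have := hvar x _ hδ (e _).summable
    rw [(e (d x)).tsum_eq, (e φ).tsum_eq, hdx] at this
    nlinarith
  · have s1 : Summable fun z => d x y * q y z := (summable_of_mem_subProb (hq y)).mul_left _
    have hle : ∀ z, d x z * q y z ≤ d x y * q y z + d y z * q y z := fun z => by
      rw [← add_mul]; exact mul_le_mul_of_nonneg_right (htri x y z) ((hq y).1 z)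
    have s2 : Summable fun z => d x z * q y z :=
      (s1.add (hs y)).of_nonneg_of_le (fun z => mul_nonneg (hd x z) ((hq y).1 z)) hle
    have h1 : ∑' z, d x z * q y z ≤ d x y + ∑' z, d y z * q y z := by
      refine (s2.tsum_le_tsum hle (s1.add (hs y))).trans ?_
      rw [s1.tsum_add (hs y), tsum_mul_left]
      nlinarith [tsum_le_one_of_mem_subProb (hq y), hd x y]
    -- The minimiser at `y` competes at `x`; by the triangle inequality its mean displacement grows
    -- by at most `d x y`. The leftover terms form `-(m x - m y) ^ 2`.
    have h2 := hvar x _ (hq y) s2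
    have h3 := mul_le_mul_of_nonneg_left h1 (hm0 x)
    nlinarith [sq_nonneg (∑' z, d x z * q x z - ∑' z, d y z * q y z)]

/-! ### Bounded functions and weighted sums. -/

/-- Boundedness of a real function. -/
def Bdd {ι : Type*} (f : ι → ℝ) : Prop := ∃ C, ∀ x, |f x| ≤ C

namespace Bdd

variable {ι : Type*} {f g : ι → ℝ}

theorem const (c : ℝ) : Bdd fun _ : ι => c := ⟨|c|, fun _ => le_rfl⟩

theorem add (hf : Bdd f) (hg : Bdd g) : Bdd fun x => f x + g x := by
  obtain ⟨C, hC⟩ := hf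
  obtain ⟨D, hD⟩ := hg
  exact ⟨C + D, fun x => (abs_add_le _ _).trans (add_le_add (hC x) (hD x))⟩

theorem sub (hf : Bdd f) (hg : Bdd g) : Bdd fun x => f x - g x := by
  obtain ⟨C, hC⟩ := hf
  obtain ⟨D, hD⟩ := hg
  exact ⟨C + D, fun x => (abs_sub _ _).trans (add_le_add (hC x) (hD x))⟩

theorem mul (hf : Bdd f) (hg : Bdd g) : Bdd fun x => f x * g x := by
  obtain ⟨C, hC⟩ := hf
  obtain ⟨D, hD⟩ := hg
  refine ⟨C * D, fun x => ?_⟩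
  rw [abs_mul]
  exact mul_le_mul (hC x) (hD x) (abs_nonneg _) ((abs_nonneg _).trans (hC x))

theorem sq (hf : Bdd f) : Bdd fun x => f x ^ 2 := by
  simpa only [pow_two] using hf.mul hf

theorem comp {κ : Type*} (hf : Bdd f) (e : κ → ι) : Bdd fun z => f (e z) :=
  hf.imp fun _ h z => h (e z)

theorem summable_mul {w : ι → ℝ} (hf : Bdd f) (hw0 : ∀ x, 0 ≤ w x) (hw : Summable w) :
    Summable fun x => w x * f x := by
  obtain ⟨C, hC⟩ := hf
  refine Summable.of_norm_bounded (hw.mul_right C) fun x => ?_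
  rw [Real.norm_eq_abs, abs_mul, abs_of_nonneg (hw0 x)]
  exact mul_le_mul_of_nonneg_left (hC x) (hw0 x)

/-- A weighted average of a bounded function is bounded, uniformly in the weights. -/
theorem abs_tsum_le {w : ι → ℝ} {C : ℝ} (hC : ∀ x, |f x| ≤ C) (hw0 : ∀ x, 0 ≤ w x)
    (hw : Summable w) (hw1 : ∑' x, w x = 1) : |∑' x, w x * f x| ≤ C := by
  have h : ∀ x, ‖w x * f x‖ ≤ w x * C := fun x => by
    rw [Real.norm_eq_abs, abs_mul, abs_of_nonneg (hw0 x)]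
    exact mul_le_mul_of_nonneg_left (hC x) (hw0 x)
  have := tsum_of_norm_bounded (hw.hasSum.mul_right C) h
  rwa [hw1, one_mul] at this

end Bdd

theorem tsum_mul_sq_le {ι : Type*} {w P Q : ι → ℝ} (hw0 : ∀ x, 0 ≤ w x) (hw : Summable w)
    (hP : Bdd P) (hQ : Bdd Q) :
    (∑' x, w x * (P x * Q x)) ^ 2 ≤ (∑' x, w x * P x ^ 2) * ∑' x, w x * Q x ^ 2 := by
  have sP := hP.sq.summable_mul hw0 hw
  have sQ := hQ.sq.summable_mul hw0 hw
  have sPQ := (hP.mul hQ).summable_mul hw0 hw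
  have h : ∀ t : ℝ, 0 ≤ (∑' x, w x * Q x ^ 2) * (t * t) + (2 * ∑' x, w x * (P x * Q x)) * t +
      ∑' x, w x * P x ^ 2 := fun t => by
    have e : (∑' x, w x * Q x ^ 2) * (t * t) + (2 * ∑' x, w x * (P x * Q x)) * t +
        ∑' x, w x * P x ^ 2 = ∑' x, w x * (P x + t * Q x) ^ 2 := by
      rw [← tsum_mul_right, ← tsum_mul_left, ← tsum_mul_right,
        ← (sQ.mul_right _).tsum_add ((sPQ.mul_left 2).mul_right t),
        ← ((sQ.mul_right _).add ((sPQ.mul_left 2).mul_right t)).tsum_add sP]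
      exact tsum_congr fun x => by ring
    rw [e]
    exact tsum_nonneg fun x => mul_nonneg (hw0 x) (sq_nonneg _)
  have := discrim_le_zero h
  rw [discrim] at this
  linarith

/-- The mass function of a probability measure, as a real function. -/
noncomputable def mass (π : PMF X) (x : X) : ℝ := (π x).toReal

theorem mass_nonneg (π : PMF X) (x : X) : 0 ≤ mass π x := ENNReal.toReal_nonneg

theorem summable_mass (π : PMF X) : Summable (mass π) :=
  ENNReal.summable_toReal π.tsum_coe_ne_top

theorem tsum_mass (π : PMF X) : ∑' x, mass π x = 1 := by
  unfold mass
  rw [← ENNReal.tsum_toReal_eq π.apply_ne_top, π.tsum_coe, ENNReal.toReal_one]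

theorem Bdd.abs_tsum_mass_le {f : X → ℝ} {C : ℝ} (hC : ∀ x, |f x| ≤ C) (π : PMF X) :
    |∑' x, mass π x * f x| ≤ C :=
  Bdd.abs_tsum_le hC (mass_nonneg π) (summable_mass π) (tsum_mass π)

theorem Bdd.summable_mass_mul {f : X → ℝ} (hf : Bdd f) (π : PMF X) :
    Summable fun x => mass π x * f x :=
  hf.summable_mul (mass_nonneg π) (summable_mass π)

theorem Bdd.of_average {F : X × X → ℝ} (hF : Bdd F) (K : X → PMF X) :
    Bdd fun x => ∑' y, mass (K x) y * F (x, y) :=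
  hF.imp fun _ hC x => Bdd.abs_tsum_mass_le (fun y => hC (x, y)) (K x)

/-! ### The generator and `Γ` on bounded functions. -/

theorem generator_eq (K : X → PMF X) (f : X → ℝ) (x : X) :
    generator K f x = ∑' y, mass (K x) y * (f y - f x) :=
  tsum_congr fun _ => mul_comm _ _

theorem generator_eq_sub (K : X → PMF X) {f : X → ℝ} (hf : Bdd f) (x : X) :
    generator K f x = ∑' y, mass (K x) y * f y - f x := by
  rw [generator_eq]
  simp only [mul_sub]
  rw [(hf.summable_mass_mul (K x)).tsum_sub ((summable_mass (K x)).mul_right _), tsum_mul_right,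
    tsum_mass, one_mul]

theorem Gam_eq (K : X → PMF X) (f g : X → ℝ) (x : X) :
    Gam K f g x = ∑' y, mass (K x) y * (1 / 2 * ((f y - f x) * (g y - g x))) := by
  unfold Gam mass
  rw [← tsum_mul_left]
  exact tsum_congr fun _ => by ring

theorem Bdd.diff {f : X → ℝ} (hf : Bdd f) : Bdd fun z : X × X => f z.2 - f z.1 :=
  (hf.comp Prod.snd).sub (hf.comp Prod.fst)

theorem Bdd.generator {f : X → ℝ} (hf : Bdd f) (K : X → PMF X) : Bdd (generator K f) := by
  have := hf.diff.of_average K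
  simpa only [← generator_eq] using this

theorem Bdd.carre {f g : X → ℝ} (hf : Bdd f) (hg : Bdd g) :
    Bdd fun z : X × X => 1 / 2 * ((f z.2 - f z.1) * (g z.2 - g z.1)) :=
  (Bdd.const _).mul (hf.diff.mul hg.diff)

theorem Bdd.Gam {f g : X → ℝ} (hf : Bdd f) (hg : Bdd g) (K : X → PMF X) : Bdd (Gam K f g) := by
  have := (hf.carre hg).of_average K
  simpa only [← Gam_eq] using this

theorem generator_combo (K : X → PMF X) {f g : X → ℝ} (hf : Bdd f) (hg : Bdd g) (a b : ℝ) (x : X) :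
    generator K (fun y => a * f y + b * g y) x = a * generator K f x + b * generator K g x := by
  rw [generator_eq_sub K (((Bdd.const a).mul hf).add ((Bdd.const b).mul hg)),
    generator_eq_sub K hf, generator_eq_sub K hg]
  have e : ∑' y, mass (K x) y * (a * f y + b * g y) =
      a * ∑' y, mass (K x) y * f y + b * ∑' y, mass (K x) y * g y := by
    rw [← tsum_mul_left, ← tsum_mul_left, ← ((hf.summable_mass_mul (K x)).mul_left a).tsum_add
      ((hg.summable_mass_mul (K x)).mul_left b)]
    exact tsum_congr fun y => by ring
  rw [e]; ring

/-! ### Reversibility, integration by parts and integrated curvature. -/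

/-- The stationary measure on the oriented edges. -/
noncomputable def edge (K : X → PMF X) (π : PMF X) (z : X × X) : ℝ := mass π z.1 * mass (K z.1) z.2

section reversible

variable {K : X → PMF X} {π : PMF X}

theorem edge_nonneg (z : X × X) : 0 ≤ edge K π z :=
  mul_nonneg (mass_nonneg _ _) (mass_nonneg _ _)

theorem summable_edge : Summable (edge K π) := by
  refine (summable_prod_of_nonneg edge_nonneg).2
    ⟨fun x => (summable_mass (K x)).mul_left (mass π x), ?_⟩
  simpa only [edge, tsum_mul_left, tsum_mass, mul_one] using summable_mass π

theorem tsum_edge {F : X × X → ℝ} (hF : Summable fun z => edge K π z * F z) :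
    ∑' z, edge K π z * F z = ∑' x, mass π x * ∑' y, mass (K x) y * F (x, y) := by
  rw [hF.tsum_prod]
  refine tsum_congr fun x => ?_
  rw [← tsum_mul_left]
  exact tsum_congr fun y => by simp only [edge]; ring

theorem Bdd.summable_edge_mul {F : X × X → ℝ} (hF : Bdd F) :
    Summable fun z => edge K π z * F z :=
  hF.summable_mul edge_nonneg summable_edge

theorem edge_swap (hπ : IsReversible K π) (z : X × X) : edge K π z.swap = edge K π z := by
  have := congrArg ENNReal.toReal (hπ z.1 z.2)
  simp only [ENNReal.toReal_mul] at this
  simp only [edge, mass, Prod.fst_swap, Prod.snd_swap]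
  linarith

theorem tsum_edge_swap (hπ : IsReversible K π) (F : X × X → ℝ) :
    ∑' z, edge K π z * F z.swap = ∑' z, edge K π z * F z := by
  rw [← (Equiv.prodComm X X).tsum_eq fun z => edge K π z * F z]
  exact tsum_congr fun z => by
    simp only [Equiv.prodComm_apply]; rw [edge_swap hπ]

theorem tsum_mass_Gam {f g : X → ℝ} (hf : Bdd f) (hg : Bdd g) :
    ∑' x, mass π x * Gam K f g x =
      ∑' z, edge K π z * (1 / 2 * ((f z.2 - f z.1) * (g z.2 - g z.1))) := by
  rw [tsum_edge (hf.carre hg).summable_edge_mul]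
  simp only [Gam_eq]

/-- Integration by parts. -/
theorem tsum_mass_Gam_eq_neg (hπ : IsReversible K π) {f g : X → ℝ} (hf : Bdd f) (hg : Bdd g) :
    ∑' x, mass π x * Gam K f g x = -∑' x, mass π x * (f x * generator K g x) := by
  have h1 : Bdd fun z : X × X => f z.1 * (g z.2 - g z.1) := (hf.comp Prod.fst).mul hg.diff
  have e1 : ∑' x, mass π x * (f x * generator K g x) =
      ∑' z, edge K π z * (f z.1 * (g z.2 - g z.1)) := by
    rw [tsum_edge h1.summable_edge_mul]
    refine tsum_congr fun x => ?_
    rw [generator_eq, ← tsum_mul_left]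
    congr 1
    exact tsum_congr fun y => by ring
  have e2 := tsum_edge_swap hπ fun z => f z.1 * (g z.2 - g z.1)
  have h2 : Bdd fun z : X × X => f z.swap.1 * (g z.swap.2 - g z.swap.1) := h1.comp Prod.swap
  rw [tsum_mass_Gam hf hg, e1]
  have e3 : ∑' z, edge K π z * (1 / 2 * ((f z.2 - f z.1) * (g z.2 - g z.1))) =
      -(1 / 2) * ∑' z, edge K π z * (f z.1 * (g z.2 - g z.1)) +
        -(1 / 2) * ∑' z, edge K π z * (f z.swap.1 * (g z.swap.2 - g z.swap.1)) := by
    rw [← tsum_mul_left, ← tsum_mul_left,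
      ← (h1.summable_edge_mul.mul_left _).tsum_add (h2.summable_edge_mul.mul_left _)]
    exact tsum_congr fun z => by simp only [Prod.fst_swap, Prod.snd_swap]; ring
  rw [e3, e2]; ring

theorem tsum_mass_generator (hπ : IsReversible K π) {g : X → ℝ} (hg : Bdd g) :
    ∑' x, mass π x * generator K g x = 0 := by
  have := tsum_mass_Gam_eq_neg hπ (Bdd.const 1) hg
  simpa [Gam] using this

theorem energy_nonneg {f : X → ℝ} (hf : Bdd f) : 0 ≤ ∑' x, mass π x * Gam K f f x := by
  rw [tsum_mass_Gam hf hf]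
  exact tsum_nonneg fun z => mul_nonneg (edge_nonneg z)
    (mul_nonneg (by norm_num) (mul_self_nonneg _))

theorem energy_cauchySchwarz {f g : X → ℝ} (hf : Bdd f) (hg : Bdd g) :
    (∑' x, mass π x * Gam K f g x) ^ 2 ≤
      (∑' x, mass π x * Gam K f f x) * ∑' x, mass π x * Gam K g g x := by
  have e : ∀ {u v : X → ℝ}, Bdd u → Bdd v → ∑' x, mass π x * Gam K u v x =
      1 / 2 * ∑' z, edge K π z * ((u z.2 - u z.1) * (v z.2 - v z.1)) := fun hu hv => by
    rw [tsum_mass_Gam hu hv, ← tsum_mul_left]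
    exact tsum_congr fun z => by ring
  rw [e hf hg, e hf hf, e hg hg]
  have := tsum_mul_sq_le edge_nonneg (summable_edge (K := K) (π := π)) hf.diff hg.diff
  simp only [sq (_ - _ : ℝ)] at this
  linarith

/-- The integrated curvature condition. -/
theorem CurvatureDimension.integrated (hπ : IsReversible K π) {κ : ℝ}
    (hCD : CurvatureDimension K κ) {g : X → ℝ} (hg : Bdd g) :
    κ * ∑' x, mass π x * Gam K g g x ≤ ∑' x, mass π x * generator K g x ^ 2 := by
  have hL := hg.generator K
  have hΓ := hg.Gam hg K
  have s1 := ((Bdd.const (1 / 2)).mul (hΓ.generator K)).summable_mass_mul π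
  have s2 := (hg.Gam hL K).summable_mass_mul π
  have e : ∑' x, mass π x * Gam₂ K g x = ∑' x, mass π x * generator K g x ^ 2 := by
    have h1 : ∑' x, mass π x * Gam₂ K g x =
        ∑' x, mass π x * (1 / 2 * generator K (Gam K g g) x) -
          ∑' x, mass π x * Gam K g (generator K g) x := by
      rw [← s1.tsum_sub s2]
      exact tsum_congr fun x => by simp only [Gam₂]; ring
    -- Stationarity removes the term `½ L Γ(g)`; integrating the other by parts leaves the square of
    -- `L g`.
    have h2 : ∑' x, mass π x * (1 / 2 * generator K (Gam K g g) x) = 0 := by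
      have := tsum_mass_generator hπ hΓ
      rw [← mul_zero (1 / 2 : ℝ), ← this, ← tsum_mul_left]
      exact tsum_congr fun x => by ring
    have h3 : ∑' x, mass π x * Gam K g (generator K g) x =
        ∑' x, mass π x * Gam K (generator K g) g x := by
      refine tsum_congr fun x => ?_
      simp only [Gam_eq]
      exact congrArg _ (tsum_congr fun y => by ring)
    rw [h1, h2, h3, tsum_mass_Gam_eq_neg hπ hL hg]
    simp only [sq, zero_sub, neg_neg]
  rw [← e, ← tsum_mul_left]
  have s3 : Summable fun x => mass π x * Gam₂ K g x := by
    have : Bdd (Gam₂ K g) := ((Bdd.const (1 / 2)).mul (hΓ.generator K)).sub (hg.Gam hL K)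
    exact this.summable_mass_mul π
  refine ((hΓ.summable_mass_mul π).mul_left κ).tsum_le_tsum (fun x => ?_) s3
  nlinarith [hCD g hg x, mass_nonneg π x]

/-- Detailed balance propagates positivity along each allowed step, starting from any point of the
support. -/
theorem mass_pos (hK : IsIrreducible K) (hπ : IsReversible K π) (x : X) : 0 < mass π x := by
  have step : ∀ a b, 0 < K a b → π a ≠ 0 → π b ≠ 0 := fun a b hab ha hb => by
    have := hπ a b
    rw [hb, mul_zero] at this
    rcases mul_eq_zero.1 this with h | h
    · exact hab.ne' h
    · exact ha h
  obtain ⟨o, ho⟩ := π.support_nonempty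
  obtain ⟨n, w, h0, hn, hw⟩ := hK o x
  have : ∀ i ≤ n, π (w i) ≠ 0 := fun i => by
    induction i with
    | zero => intro _; rw [h0]; exact ho
    | succ i ih => exact fun hi => step _ _ (hw i hi) (ih (by omega))
  have hx := this n le_rfl
  rw [hn] at hx
  exact ENNReal.toReal_pos hx (π.apply_ne_top x)

/-- A square integrable harmonic function is constant. -/
theorem eq_of_harmonic (hK : IsIrreducible K) (hπ : IsReversible K π) {u : X → ℝ}
    (hu : Summable fun x => mass π x * u x ^ 2) (hh : ∀ x, ∑' y, mass (K x) y * u y = u x)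
    (x y : X) : u x = u y := by
  -- As `u` need not be bounded, summability is checked by hand. The aim is that `∑ edge (u y - u
  -- x)²` equals `2‖u‖² - 2⟨u, Ku⟩ = 0`, so `u` agrees across every edge.
  have s1 : Summable fun z : X × X => edge K π z * u z.1 ^ 2 := by
    refine (summable_prod_of_nonneg
      fun z => mul_nonneg (edge_nonneg z) (sq_nonneg _)).2 ⟨fun a => ?_, ?_⟩
    · exact ((summable_mass (K a)).mul_left (mass π a)).mul_right (u a ^ 2)
    · simpa only [edge, tsum_mul_right, tsum_mul_left, tsum_mass, mul_one] using hu
  have s2 : Summable fun z : X × X => edge K π z * u z.2 ^ 2 := by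
    have := s1.prod_symm
    refine this.congr fun z => ?_
    rw [edge_swap hπ, Prod.fst_swap]
  have s3 : Summable fun z : X × X => edge K π z * (u z.1 * u z.2) := by
    refine Summable.of_norm_bounded (s1.add s2) fun z => ?_
    rw [Real.norm_eq_abs, abs_mul, abs_of_nonneg (edge_nonneg z), ← mul_add]
    refine mul_le_mul_of_nonneg_left ?_ (edge_nonneg z)
    rw [abs_le]
    constructor <;> nlinarith [sq_nonneg (u z.1 + u z.2), sq_nonneg (u z.1 - u z.2),
      sq_nonneg (u z.1), sq_nonneg (u z.2)]
  have e1 : ∑' z, edge K π z * u z.1 ^ 2 = ∑' x, mass π x * u x ^ 2 := by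
    rw [tsum_edge s1]
    refine tsum_congr fun a => ?_
    change mass π a * ∑' y, mass (K a) y * u a ^ 2 = _
    rw [tsum_mul_right, tsum_mass, one_mul]
  have e2 : ∑' z, edge K π z * u z.2 ^ 2 = ∑' x, mass π x * u x ^ 2 := by
    rw [← e1]
    exact tsum_edge_swap hπ fun z => u z.1 ^ 2
  have e3 : ∑' z, edge K π z * (u z.1 * u z.2) = ∑' x, mass π x * u x ^ 2 := by
    rw [tsum_edge s3]
    refine tsum_congr fun a => ?_
    have : ∑' b, mass (K a) b * (u a * u b) = u a * ∑' b, mass (K a) b * u b := by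
      rw [← tsum_mul_left]; exact tsum_congr fun b => by ring
    rw [this, hh, sq]
  have s4 : Summable fun z : X × X => edge K π z * (u z.2 - u z.1) ^ 2 := by
    refine ((s1.add s2).sub (s3.mul_left 2)).congr fun z => by ring
  have e4 : ∑' z, edge K π z * (u z.2 - u z.1) ^ 2 = 0 := by
    have : ∑' z, edge K π z * (u z.2 - u z.1) ^ 2 =
        ∑' z, edge K π z * u z.1 ^ 2 + ∑' z, edge K π z * u z.2 ^ 2 -
          2 * ∑' z, edge K π z * (u z.1 * u z.2) := by
      rw [← tsum_mul_left, ← s1.tsum_add s2, ← (s1.add s2).tsum_sub (s3.mul_left 2)]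
      exact tsum_congr fun z => by ring
    rw [this, e1, e2, e3]; ring
  have step : ∀ a b, 0 < K a b → u b = u a := fun a b hab => by
    have h := s4.le_tsum (a, b) fun z _ => mul_nonneg (edge_nonneg z) (sq_nonneg _)
    rw [e4] at h
    have hpos : 0 < edge K π (a, b) :=
      mul_pos (mass_pos hK hπ a) (ENNReal.toReal_pos hab.ne' ((K a).apply_ne_top b))
    have h0 : (u b - u a) ^ 2 ≤ 0 := by
      by_contra! hc
      exact absurd h (not_le.2 (mul_pos hpos hc))
    exact sub_eq_zero.1 (pow_eq_zero_iff two_ne_zero |>.1 (le_antisymm h0 (sq_nonneg _)))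
  obtain ⟨n, w, h0, hn, hw⟩ := hK x y
  have : ∀ i ≤ n, u (w i) = u x := fun i => by
    induction i with
    | zero => intro _; rw [h0]
    | succ i ih => exact fun hi => (step _ _ (hw i hi)).trans (ih (by omega))
  rw [← hn, this n le_rfl]

end reversible

/-! ### Density of the range of the generator, Poincaré and covariance inequalities. -/

/-- The embedding of bounded functions into `ℓ²` through `f ↦ √π f`. -/
noncomputable def l2Embed (π : PMF X) (f : X → ℝ) (hf : Bdd f) : lp (fun _ : X => ℝ) 2 :=
  ⟨fun x => √(mass π x) * f x, by
    refine memℓp_gen ?_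
    refine (hf.sq.summable_mass_mul π).congr fun x => ?_
    simp only [Real.norm_eq_abs, ENNReal.toReal_ofNat, Real.rpow_ofNat, sq_abs]
    rw [mul_pow, Real.sq_sqrt (mass_nonneg π x)]⟩

theorem l2Embed_apply (π : PMF X) {f : X → ℝ} (hf : Bdd f) (x : X) :
    l2Embed π f hf x = √(mass π x) * f x := rfl

theorem inner_l2Embed (π : PMF X) {f g : X → ℝ} (hf : Bdd f) (hg : Bdd g) :
    inner ℝ (l2Embed π f hf) (l2Embed π g hg) = ∑' x, mass π x * (f x * g x) := by
  rw [lp.inner_eq_tsum]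
  refine tsum_congr fun x => ?_
  rw [l2Embed_apply, l2Embed_apply]
  simp only [RCLike.inner_apply, conj_trivial]
  linear_combination (f x * g x) * Real.mul_self_sqrt (mass_nonneg π x)

theorem norm_sq_l2Embed (π : PMF X) {f : X → ℝ} (hf : Bdd f) :
    ‖l2Embed π f hf‖ ^ 2 = ∑' x, mass π x * f x ^ 2 := by
  rw [← real_inner_self_eq_norm_sq, inner_l2Embed]
  simp only [sq]

/-- The image in `ℓ²` of the bounded functions under the generator. -/
noncomputable def generatorRange (K : X → PMF X) (π : PMF X) :
    Submodule ℝ (lp (fun _ : X => ℝ) 2) where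
  carrier := {v | ∃ (g : X → ℝ) (hg : Bdd g), v = l2Embed π (generator K g) (hg.generator K)}
  zero_mem' := by
    refine ⟨fun _ => 0, Bdd.const 0, ?_⟩
    ext x
    simp [l2Embed_apply, generator]
  add_mem' := by
    rintro _ _ ⟨f, hf, rfl⟩ ⟨g, hg, rfl⟩
    refine ⟨fun y => 1 * f y + 1 * g y, ((Bdd.const 1).mul hf).add ((Bdd.const 1).mul hg), ?_⟩
    ext x
    rw [lp.coeFn_add, Pi.add_apply]
    simp only [l2Embed_apply]
    rw [generator_combo K hf hg]
    ring
  smul_mem' := by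
    rintro c _ ⟨f, hf, rfl⟩
    refine ⟨fun y => c * f y + 0 * f y, ((Bdd.const c).mul hf).add ((Bdd.const 0).mul hf), ?_⟩
    ext x
    rw [lp.coeFn_smul, Pi.smul_apply, smul_eq_mul]
    simp only [l2Embed_apply]
    rw [generator_combo K hf hf]
    ring

section reversible

variable {K : X → PMF X} {π : PMF X} (hK : IsIrreducible K) (hπ : IsReversible K π)

include hK hπ

/-- The closure is the double orthogonal complement. If `u` is orthogonal to the range, testing
against the generator of point masses shows that `u / √π` is harmonic, hence constant; such a `u` is
orthogonal to every centred `h`. -/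
theorem mem_closure_generatorRange {h : X → ℝ} (hh : Bdd h) (h0 : ∑' x, mass π x * h x = 0) :
    l2Embed π h hh ∈ (generatorRange K π).topologicalClosure := by
  classical
  rw [← Submodule.orthogonal_orthogonal_eq_closure, Submodule.mem_orthogonal]
  intro u hu
  rw [Submodule.mem_orthogonal] at hu
  have hpos := fun x => mass_pos hK hπ x
  have hsq : ∀ x, √(mass π x) * √(mass π x) = mass π x := fun x =>
    Real.mul_self_sqrt (hpos x).le
  have hs0 : ∀ x, √(mass π x) ≠ 0 := fun x => (Real.sqrt_pos.2 (hpos x)).ne'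
  set U : X → ℝ := fun x => u x / √(mass π x) with hU
  have hUu : ∀ x, u x = √(mass π x) * U x := fun x => by
    simp only [hU]; field_simp [hs0 x]
  have hsum : Summable fun x => mass π x * U x ^ 2 := by
    refine (lp.summable_inner (𝕜 := ℝ) u u).congr fun x => ?_
    rw [hUu]
    simp only [RCLike.inner_apply, conj_trivial]
    linear_combination U x ^ 2 * hsq x
  have hharm : ∀ z, ∑' x, mass (K z) x * U x = U z := fun z => by
    set g : X → ℝ := Pi.single z 1 with hg
    have hgb : Bdd g := ⟨1, fun x => by
      rcases eq_or_ne x z with rfl | hx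
      · simp [hg]
      · simp [hg, hx]⟩
    have hgen : ∀ x, generator K g x = mass (K x) z - g x := fun x => by
      rw [generator_eq_sub K hgb, tsum_eq_single z fun y hy => by simp [hg, hy]]
      simp [hg]
    have hi := hu _ ⟨g, hgb, rfl⟩
    have hsum2 := lp.hasSum_inner (𝕜 := ℝ) (l2Embed π (generator K g) (hgb.generator K)) u
    rw [hi] at hsum2
    have e : ∀ x, inner ℝ (l2Embed π (generator K g) (hgb.generator K) x) (u x) =
        mass π z * (mass (K z) x * U x) - mass π z * (U z * g x) := fun x => by
      have hrev := edge_swap hπ (z, x)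
      simp only [edge, Prod.swap] at hrev
      rw [l2Embed_apply, hgen, hUu x]
      simp only [RCLike.inner_apply, conj_trivial]
      rcases eq_or_ne x z with rfl | hx
      · linear_combination (mass (K x) x - g x) * U x * hsq x
      · have : g x = 0 := by simp [hg, hx]
        rw [this]
        linear_combination mass (K x) z * U x * hsq x + U x * hrev
    simp only [e] at hsum2
    have hδ : HasSum (fun x => mass π z * (U z * g x)) (mass π z * U z) := by
      convert hasSum_single z fun y hy => ?_ using 1
      · simp [hg]
      · simp [hg, hy]
    have h3 := hsum2.add hδ
    simp only [sub_add_cancel, zero_add] at h3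
    have h4 := h3.tsum_eq
    rw [tsum_mul_left] at h4
    exact mul_left_cancel₀ (hpos z).ne' h4
  obtain ⟨o, -⟩ := π.support_nonempty
  have hconst := fun x => eq_of_harmonic hK hπ hsum hharm x o
  rw [lp.inner_eq_tsum]
  have e : ∀ x, inner ℝ (u x) (l2Embed π h hh x) = U o * (mass π x * h x) := fun x => by
    rw [l2Embed_apply, hUu x, hconst x]
    simp only [RCLike.inner_apply, conj_trivial]
    linear_combination U o * h x * hsq x
  simp only [e]
  rw [tsum_mul_left, h0, mul_zero]

variable {κ : ℝ} (hκ : 0 < κ) (hCD : CurvatureDimension K κ)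

include hκ hCD

/-- The Poincaré inequality for a bounded centred function. -/
theorem poincare_centred {h : X → ℝ} (hh : Bdd h) (h0 : ∑' x, mass π x * h x = 0) :
    κ * ∑' x, mass π x * h x ^ 2 ≤ ∑' x, mass π x * Gam K h h x := by
  set A := ∑' x, mass π x * Gam K h h x with hA
  have hA0 : 0 ≤ A := energy_nonneg hh
  -- This inequality holds for `v = L g` by Cauchy–Schwarz and integrated curvature. Being closed in
  -- `v`, it extends to `v = h`, where it reads `κ ‖h‖⁴ ≤ A ‖h‖²`.
  have hclosed : IsClosed {v : lp (fun _ : X => ℝ) 2 |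
      κ * inner ℝ (l2Embed π h hh) v ^ 2 ≤ A * ‖v‖ ^ 2} :=
    isClosed_le (by fun_prop) (by fun_prop)
  have hsub : (generatorRange K π : Set (lp (fun _ : X => ℝ) 2)) ⊆
      {v | κ * inner ℝ (l2Embed π h hh) v ^ 2 ≤ A * ‖v‖ ^ 2} := by
    rintro _ ⟨g, hg, rfl⟩
    change κ * _ ^ 2 ≤ A * _
    rw [inner_l2Embed, norm_sq_l2Embed]
    have h1 := energy_cauchySchwarz (K := K) (π := π) hh hg
    rw [tsum_mass_Gam_eq_neg hπ hh hg, neg_sq] at h1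
    have h2 := hCD.integrated hπ hg
    calc _ ≤ κ * (A * ∑' x, mass π x * Gam K g g x) := mul_le_mul_of_nonneg_left h1 hκ.le
      _ = A * (κ * ∑' x, mass π x * Gam K g g x) := by ring
      _ ≤ _ := mul_le_mul_of_nonneg_left h2 hA0
  have hmem : κ * inner ℝ (l2Embed π h hh) (l2Embed π h hh) ^ 2 ≤ A * ‖l2Embed π h hh‖ ^ 2 :=
    closure_minimal hsub hclosed (mem_closure_generatorRange hK hπ hh h0)
  rw [real_inner_self_eq_norm_sq, norm_sq_l2Embed] at hmem
  have hN : 0 ≤ ∑' x, mass π x * h x ^ 2 :=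
    tsum_nonneg fun x => mul_nonneg (mass_nonneg π x) (sq_nonneg _)
  rcases hN.eq_or_lt with hN | hN
  · rw [← hN, mul_zero]; exact hA0
  · refine le_of_mul_le_mul_right ?_ hN
    linarith

theorem poincare {h : X → ℝ} (hh : Bdd h) :
    κ * ∑' x, mass π x * (h x - ∑' y, mass π y * h y) ^ 2 ≤ ∑' x, mass π x * Gam K h h x := by
  set c := ∑' y, mass π y * h y with hc
  have h1 := poincare_centred hK hπ hκ hCD (hh.sub (Bdd.const c)) (by
    simp only [mul_sub]
    rw [(hh.summable_mass_mul π).tsum_sub ((summable_mass π).mul_right c), tsum_mul_right,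
      tsum_mass, ← hc]
    ring)
  refine h1.trans_eq (tsum_congr fun x => ?_)
  simp only [Gam, sub_sub_sub_cancel_right]

/-- Cauchy–Schwarz for the covariance, then Poincaré for each variance: hence the factor `κ ^ 2`. -/
theorem covariance_sq_le {f g : X → ℝ} (hf : Bdd f) (hg : Bdd g) :
    κ ^ 2 * (∑' x, mass π x * (f x * g x) -
        (∑' x, mass π x * f x) * ∑' x, mass π x * g x) ^ 2 ≤
      (∑' x, mass π x * Gam K f f x) * ∑' x, mass π x * Gam K g g x := by
  have hPf := poincare hK hπ hκ hCD hf
  have hPg := poincare hK hπ hκ hCD hg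
  set a := ∑' x, mass π x * f x with ha
  set b := ∑' x, mass π x * g x with hb
  have h1 := tsum_mul_sq_le (mass_nonneg π) (summable_mass π) (hf.sub (Bdd.const a))
    (hg.sub (Bdd.const b))
  clear_value a b
  have e : ∑' x, mass π x * ((f x - a) * (g x - b)) = ∑' x, mass π x * (f x * g x) - a * b := by
    have s1 := (hf.mul hg).summable_mass_mul π
    have s2 := (hf.summable_mass_mul π).mul_right b
    have s3 := (hg.summable_mass_mul π).mul_right a
    have s4 := (summable_mass π).mul_right (a * b)
    have : ∑' x, mass π x * ((f x - a) * (g x - b)) = ∑' x, mass π x * (f x * g x) -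
        (∑' x, mass π x * f x) * b - (∑' x, mass π x * g x) * a +
          (∑' x, mass π x) * (a * b) := by
      rw [← tsum_mul_right, ← tsum_mul_right, ← tsum_mul_right, ← s1.tsum_sub s2,
        ← (s1.sub s2).tsum_sub s3, ← ((s1.sub s2).sub s3).tsum_add s4]
      exact tsum_congr fun x => by ring
    rw [this, tsum_mass, ← ha, ← hb]
    ring
  rw [e] at h1
  have hVf : 0 ≤ ∑' x, mass π x * (f x - a) ^ 2 :=
    tsum_nonneg fun x => mul_nonneg (mass_nonneg π x) (sq_nonneg _)
  have hVg : 0 ≤ ∑' x, mass π x * (g x - b) ^ 2 :=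
    tsum_nonneg fun x => mul_nonneg (mass_nonneg π x) (sq_nonneg _)
  calc _ ≤ κ ^ 2 * ((∑' x, mass π x * (f x - a) ^ 2) * ∑' x, mass π x * (g x - b) ^ 2) :=
        mul_le_mul_of_nonneg_left h1 (sq_nonneg _)
    _ = (κ * ∑' x, mass π x * (f x - a) ^ 2) * (κ * ∑' x, mass π x * (g x - b) ^ 2) := by ring
    _ ≤ _ := mul_le_mul hPf hPg (mul_nonneg hκ.le hVg) (energy_nonneg hf)

/-- The covariance of a bounded function with a nonnegative integrable function is controlled by
the energies, where the energy of the second one is bounded through its truncations. -/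
theorem covariance_sq_le_of_truncation {f g : X → ℝ} (hf0 : ∀ x, 0 ≤ f x)
    (hf : Summable fun x => mass π x * f x) (hg : Bdd g) {E : ℝ}
    (hE : ∀ n : ℕ, ∑' x, mass π x * Gam K (fun y => min (f y) n) (fun y => min (f y) n) x ≤ E) :
    κ ^ 2 * (∑' x, mass π x * (g x * f x) -
        (∑' x, mass π x * g x) * ∑' x, mass π x * f x) ^ 2 ≤
      (∑' x, mass π x * Gam K g g x) * E := by
  have hb : ∀ n : ℕ, Bdd fun x => min (f x) (n : ℝ) := fun n => ⟨n, fun x => by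
    rw [abs_of_nonneg (le_min (hf0 x) n.cast_nonneg)]; exact min_le_right _ _⟩
  have hmin : ∀ x, Filter.Tendsto (fun n : ℕ => min (f x) (n : ℝ)) Filter.atTop (nhds (f x)) :=
    fun x => by
      refine tendsto_const_nhds.congr' ?_
      filter_upwards [Filter.eventually_ge_atTop ⌈f x⌉₊] with n hn
      exact (min_eq_left (Nat.ceil_le.1 hn)).symm
  have hlim : ∀ {u : X → ℝ}, Bdd u → Filter.Tendsto
      (fun n : ℕ => ∑' x, mass π x * (u x * min (f x) (n : ℝ))) Filter.atTop
      (nhds (∑' x, mass π x * (u x * f x))) := by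
    rintro u ⟨C, hC⟩
    refine tendsto_tsum_of_dominated_convergence (hf.mul_left C)
      (fun x => ((hmin x).const_mul (u x)).const_mul _) (Filter.Eventually.of_forall fun n x => ?_)
    rw [Real.norm_eq_abs, abs_mul, abs_mul, abs_of_nonneg (mass_nonneg π x),
      abs_of_nonneg (le_min (hf0 x) n.cast_nonneg)]
    have := mul_le_mul (hC x) (min_le_left (f x) n) (le_min (hf0 x) n.cast_nonneg)
      ((abs_nonneg _).trans (hC x))
    nlinarith [mass_nonneg π x]
  have h1 := hlim (Bdd.const 1)
  simp only [one_mul] at h1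
  refine le_of_tendsto' ((((hlim hg).sub (h1.const_mul (∑' x, mass π x * g x))).pow 2).const_mul
    (κ ^ 2)) fun n => ?_
  exact (covariance_sq_le hK hπ hκ hCD hg (hb n)).trans
    (mul_le_mul_of_nonneg_left (hE n) (energy_nonneg hg))

end reversible

/-! ### The graph distance. -/

section graphDist

variable {K : X → PMF X}

theorem graphDist_le_of_isWalk {n : ℕ} {x y : X} (h : IsWalk K n x y) : graphDist K x y ≤ n :=
  iInf₂_le n h

theorem IsWalk.trans {n k : ℕ} {x y z : X} (h₁ : IsWalk K n x y) (h₂ : IsWalk K k y z) :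
    IsWalk K (n + k) x z := by
  obtain ⟨v, hv0, hvn, hv⟩ := h₁
  obtain ⟨w, hw0, hwk, hw⟩ := h₂
  refine ⟨fun i => if i < n then v i else w (i - n), ?_, ?_, fun i hi => ?_⟩
  · rcases Nat.eq_zero_or_pos n with rfl | hn
    · simp [hw0, ← hvn, hv0]
    · simp [hn, hv0]
  · simp [hwk]
  · rcases lt_trichotomy (i + 1) n with h | h | h
    · simpa [h, (Nat.lt_succ_self i).trans h] using hv i (by omega)
    -- At the junction the concatenated walk already reads `w 0`, which equals `v n`.
    · have := hv i (by omega)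
      rw [h, hvn, ← hw0] at this
      simpa [h, show i < n by omega] using this
    · have := hw (i - n) (by omega)
      rw [show i - n + 1 = i + 1 - n by omega] at this
      simpa [show ¬ i < n by omega, show ¬ i + 1 < n by omega] using this

theorem IsIrreducible.exists_isWalk_eq_graphDist (hK : IsIrreducible K) (x y : X) :
    ∃ n : ℕ, IsWalk K n x y ∧ graphDist K x y = n := by
  classical
  refine ⟨Nat.find (hK x y), Nat.find_spec (hK x y),
    le_antisymm (graphDist_le_of_isWalk (Nat.find_spec (hK x y))) (le_iInf₂ fun k hk => ?_)⟩
  exact_mod_cast Nat.find_min' (hK x y) hk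

theorem graphDist_self (x : X) : graphDist K x x = 0 := by
  have h : IsWalk K 0 x x := ⟨fun _ => x, rfl, rfl, fun i hi => absurd hi (Nat.not_lt_zero i)⟩
  simpa using graphDist_le_of_isWalk h

theorem graphDist_le_one {x y : X} (h : 0 < K x y) : graphDist K x y ≤ 1 := by
  have h : IsWalk K 1 x y := ⟨fun i => if i = 0 then x else y, rfl, rfl, fun i hi => by
    obtain rfl : i = 0 := by omega
    simpa using h⟩
  simpa using graphDist_le_of_isWalk h

theorem IsIrreducible.graphDist_ne_top (hK : IsIrreducible K) (x y : X) :
    graphDist K x y ≠ ⊤ := by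
  obtain ⟨n, -, hn⟩ := hK.exists_isWalk_eq_graphDist x y
  simp [hn]

theorem IsIrreducible.graphDist_triangle (hK : IsIrreducible K) (x y z : X) :
    graphDist K x z ≤ graphDist K x y + graphDist K y z := by
  obtain ⟨n, hn, en⟩ := hK.exists_isWalk_eq_graphDist x y
  obtain ⟨k, hk, ek⟩ := hK.exists_isWalk_eq_graphDist y z
  rw [en, ek]
  exact_mod_cast graphDist_le_of_isWalk (hn.trans hk)

end graphDist

/-! ### Energy bounds from slopes and truncations. -/

theorem le_maxJumpRate (K : X → PMF X) (x : X) : 1 - mass (K x) x ≤ maxJumpRate K := by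
  refine le_ciSup (f := fun x => 1 - (K x x).toReal) ⟨1, ?_⟩ x
  rintro _ ⟨y, rfl⟩
  exact sub_le_self _ ENNReal.toReal_nonneg

theorem mass_le_one (π : PMF X) (x : X) : mass π x ≤ 1 :=
  ENNReal.toReal_le_of_le_ofReal zero_le_one (by simpa using π.coe_le_one x)

theorem maxJumpRate_nonneg (K : X → PMF X) : 0 ≤ maxJumpRate K :=
  Real.iSup_nonneg fun x => sub_nonneg.2 (mass_le_one (K x) x)

/-- The energy of a function is controlled by the square of its descending slope. -/
theorem energy_le_of_slope {K : X → PMF X} {π : PMF X} (hπ : IsReversible K π) {g m : X → ℝ}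
    (hg : Bdd g) (hm : Bdd m) (hm0 : ∀ x, 0 ≤ m x)
    (h : ∀ x y, 0 < K x y → g x - g y ≤ 2 * m x) :
    ∑' x, mass π x * Gam K g g x ≤ 4 * maxJumpRate K * ∑' x, mass π x * m x ^ 2 := by
  classical
  have hind : Bdd fun z : X × X => if z.2 = z.1 then (0 : ℝ) else 1 :=
    ⟨1, fun z => by beta_reduce; split_ifs <;> simp⟩
  -- On each edge `½ (g y - g x)²` is at most `2 m²` at the endpoint where `g` is larger, hence at
  -- most `F` plus its swap. Loops are excluded so that the row sums give `1 - K(x,x)`; swap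
  -- symmetry doubles the `2` to the final `4`.
  set F : X × X → ℝ := fun z => 2 * (m z.1 ^ 2 * if z.2 = z.1 then 0 else 1) with hF
  have hFb : Bdd F := (Bdd.const 2).mul ((hm.sq.comp Prod.fst).mul hind)
  have hFs : Bdd fun z : X × X => F z.swap := hFb.comp Prod.swap
  have eF : ∑' z, edge K π z * F z = ∑' x, mass π x * (2 * m x ^ 2 * (1 - mass (K x) x)) := by
    rw [tsum_edge hFb.summable_edge_mul]
    refine tsum_congr fun x => ?_
    have h1 : HasSum (fun y => mass (K x) y * F (x, y))
        (2 * m x ^ 2 * 1 - 2 * m x ^ 2 * mass (K x) x) := by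
      have s1 := (summable_mass (K x)).hasSum.mul_left (2 * m x ^ 2)
      rw [tsum_mass] at s1
      have s2 := (hasSum_ite_eq x (mass (K x) x)).mul_left (2 * m x ^ 2)
      refine (s1.sub s2).congr_fun fun y => ?_
      simp only [hF]
      split_ifs with hy
      · rw [hy]; ring
      · ring
    rw [h1.tsum_eq]; ring
  rw [tsum_mass_Gam hg hg]
  have hle : ∑' z, edge K π z * (1 / 2 * ((g z.2 - g z.1) * (g z.2 - g z.1))) ≤
      ∑' z, edge K π z * F z + ∑' z, edge K π z * F z.swap := by
    rw [← hFb.summable_edge_mul.tsum_add hFs.summable_edge_mul]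
    refine (hg.carre hg).summable_edge_mul.tsum_le_tsum (fun z => ?_)
      (hFb.summable_edge_mul.add hFs.summable_edge_mul)
    rw [← mul_add]
    rcases (edge_nonneg (K := K) (π := π) z).eq_or_lt with h0 | h0
    · rw [← h0, zero_mul, zero_mul]
    · refine mul_le_mul_of_nonneg_left ?_ h0.le
      have hpos : ∀ w : X × X, 0 < edge K π w → 0 < K w.1 w.2 := fun w hw =>
        (ENNReal.toReal_pos_iff.1 (pos_of_mul_pos_right hw (mass_nonneg _ _))).1
      have h1 := h _ _ (hpos z h0)
      have h2 := h _ _ (hpos z.swap (by rwa [edge_swap hπ]))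
      simp only [Prod.fst_swap, Prod.snd_swap] at h2
      simp only [hF, Prod.fst_swap, Prod.snd_swap]
      rcases eq_or_ne z.2 z.1 with he | he
      · simp [he]
      · simp only [he, he.symm, if_false, mul_one]
        have hm1 := hm0 z.1
        have hm2 := hm0 z.2
        rcases le_total (g z.1) (g z.2) with hc | hc <;> nlinarith
  refine hle.trans ?_
  rw [tsum_edge_swap hπ F, eF, ← two_mul, ← tsum_mul_left, ← tsum_mul_left]
  have hJ1 : Bdd fun x => 1 - mass (K x) x := ⟨1, fun x => by
    rw [abs_of_nonneg (sub_nonneg.2 (mass_le_one (K x) x))]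
    exact sub_le_self _ (mass_nonneg _ _)⟩
  refine Summable.tsum_le_tsum (fun x => ?_)
    (((((Bdd.const 2).mul hm.sq).mul hJ1).summable_mass_mul π).mul_left 2)
    ((hm.sq.summable_mass_mul π).mul_left _)
  have := mul_le_mul_of_nonneg_left (le_maxJumpRate K x)
    (mul_nonneg (mass_nonneg π x) (sq_nonneg (m x)))
  linarith

theorem eGam_min_le (K : X → PMF X) (f : X → ℝ) (n : ℝ) (x : X) :
    eGam K (fun y => min (f y) n) x ≤ eGam K f x := by
  unfold eGam
  refine mul_le_mul_right (ENNReal.tsum_le_tsum fun y => mul_le_mul_left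
    (ENNReal.ofReal_le_ofReal ?_) _) _
  exact sq_le_sq.2 (by simpa using abs_min_sub_min_le_max (f y) n (f x) n)

/-- Truncation is a contraction. The energy of the possibly unbounded `f` is taken in `[0, ∞]`,
because a divergent real series would have the default value `0`. -/
theorem energy_min_le (K : X → PMF X) (π : PMF X) {f : X → ℝ} (hf0 : ∀ x, 0 ≤ f x)
    (hE : dirichletEnergy K π f ≠ ⊤) (n : ℕ) :
    ∑' x, mass π x * Gam K (fun y => min (f y) n) (fun y => min (f y) n) x ≤
      (dirichletEnergy K π f).toReal := by
  have hb : Bdd fun x => min (f x) (n : ℝ) := ⟨n, fun x => by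
    rw [abs_of_nonneg (le_min (hf0 x) n.cast_nonneg)]; exact min_le_right _ _⟩
  have hΓ0 : ∀ x, 0 ≤ Gam K (fun y => min (f y) n) (fun y => min (f y) n) x := fun x =>
    mul_nonneg (by norm_num)
      (tsum_nonneg fun y => mul_nonneg (mul_self_nonneg _) ENNReal.toReal_nonneg)
  have hs := (hb.Gam hb K).summable_mass_mul π
  rw [← ENNReal.ofReal_le_iff_le_toReal hE,
    ENNReal.ofReal_tsum_of_nonneg (fun x => mul_nonneg (mass_nonneg π x) (hΓ0 x)) hs]
  refine ENNReal.tsum_le_tsum fun x => ?_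
  rw [ENNReal.ofReal_mul (mass_nonneg π x), mass, ENNReal.ofReal_toReal (π.apply_ne_top x),
    mul_comm, ← eGam_eq_ofReal K _ hb]
  exact mul_le_mul_left (eGam_min_le K f n x) _

/-! ### The dual bound. -/

/-- The dual bound for the weak transport cost between a reversible probability measure and a
measure with given density. -/
theorem weakTransport_dual_bound {K : X → PMF X} {π : PMF X} (hK : IsIrreducible K)
    (hπ : IsReversible K π) {κ : ℝ} (hκ : 0 < κ) (hCD : CurvatureDimension K κ)
    {f : X → ℝ} (hf0 : ∀ x, 0 ≤ f x) (hfs : Summable fun x => mass π x * f x)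
    (hf1 : ∑' x, mass π x * f x = 1) (hE : dirichletEnergy K π f ≠ ⊤)
    {φ : X → ℝ} (hφ0 : ∀ y, 0 ≤ φ y) (hφ : Summable φ) :
    ∃ q ∈ subKernel X,
      kernelCost (fun x y => (graphDist K x y).toReal) (fun x => mass π x * f x) q ≠ ⊤ ∧
        (kernelCost (fun x y => (graphDist K x y).toReal) (fun x => mass π x * f x) q).toReal +
          ∑' y, φ y * (mass π y - push (fun x => mass π x * f x) q y) ≤
            maxJumpRate K / κ ^ 2 * (dirichletEnergy K π f).toReal := by
  set μ : X → ℝ := fun x => mass π x * f x with hμ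
  have hμ0 : ∀ x, 0 ≤ μ x := fun x => mul_nonneg (mass_nonneg π x) (hf0 x)
  obtain ⟨q, hq, m, Q, hm0, hmb, hdm, hQ, hQb, hQφ, hslope⟩ :=
    exists_infConvolution (d := fun x y => (graphDist K x y).toReal)
      (fun _ _ => ENNReal.toReal_nonneg) (fun x => by rw [graphDist_self, ENNReal.toReal_zero])
      (fun x y z => by
        rw [← ENNReal.toReal_add (hK.graphDist_ne_top x y) (hK.graphDist_ne_top y z)]
        exact ENNReal.toReal_mono
          (ENNReal.add_ne_top.2 ⟨hK.graphDist_ne_top x y, hK.graphDist_ne_top y z⟩)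
          (hK.graphDist_triangle x y z))
      hφ0 hφ
  have hφle : ∀ y, φ y ≤ ∑' z, φ z := fun y => hφ.le_tsum y fun z _ => hφ0 z
  have hφabs : ∀ y, |φ y| ≤ ∑' z, φ z := fun y => by rw [abs_of_nonneg (hφ0 y)]; exact hφle y
  have hφb : Bdd φ := ⟨_, hφabs⟩
  have hQB : Bdd Q := ⟨_, hQb⟩
  have hm2B : Bdd fun x => m x ^ 2 := ⟨∑' y, φ y, fun x => by
    rw [abs_of_nonneg (sq_nonneg _)]; exact hmb x⟩
  have hmB : Bdd m := ⟨√(∑' y, φ y), fun x => by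
    rw [abs_of_nonneg (hm0 x)]; exact Real.le_sqrt_of_sq_le (hmb x)⟩
  have sμm := hm2B.summable_mul hμ0 hfs
  have hcost : kernelCost (fun x y => (graphDist K x y).toReal) μ q =
      ENNReal.ofReal (∑' x, μ x * m x ^ 2) := by
    rw [ENNReal.ofReal_tsum_of_nonneg (fun x => mul_nonneg (hμ0 x) (sq_nonneg _)) sμm]
    refine tsum_congr fun x => ?_
    rw [hdm, ENNReal.ofReal_mul (hμ0 x), ENNReal.ofReal_pow (hm0 x)]
  refine ⟨q, hq, by rw [hcost]; exact ENNReal.ofReal_ne_top, ?_⟩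
  rw [hcost, ENNReal.toReal_ofReal
    (tsum_nonneg fun x => mul_nonneg (hμ0 x) (sq_nonneg _))]
  set A := ∑' x, mass π x * m x ^ 2 with hA
  set E := (dirichletEnergy K π f).toReal
  have hA0 : 0 ≤ A := tsum_nonneg fun x => mul_nonneg (mass_nonneg π x) (sq_nonneg _)
  have hE0 : 0 ≤ E := ENNReal.toReal_nonneg
  have hcov := covariance_sq_le_of_truncation hK hπ hκ hCD hf0 hfs hQB (energy_min_le K π hf0 hE)
  rw [hf1, mul_one] at hcov
  have hΓ := energy_le_of_slope hπ hQB hmB hm0 fun x y hxy => by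
    have h1 : (graphDist K x y).toReal ≤ 1 :=
      ENNReal.toReal_le_of_le_ofReal zero_le_one (by simpa using graphDist_le_one hxy)
    exact (hslope x y).trans
      (mul_le_of_le_one_right (mul_nonneg zero_le_two (hm0 x)) h1)
  have sπφ := hφb.summable_mass_mul π
  have sπQ := hQB.summable_mass_mul π
  -- This `-A` absorbs the `A` that the covariance estimate costs.
  have hgap : ∑' x, mass π x * Q x + ∑' x, mass π x * φ x ≤ -A := by
    rw [hA, ← tsum_neg, ← sπQ.tsum_add sπφ]
    refine (sπQ.add sπφ).tsum_le_tsum (fun x => ?_) (hm2B.summable_mass_mul π).neg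
    nlinarith [hQφ x, mass_nonneg π x]
  have hpush : ∑' y, φ y * (mass π y - push μ q y) =
      ∑' y, mass π y * φ y - ∑' x, μ x * ∑' y, φ y * q x y := by
    rw [← tsum_push_mul hμ0 hfs hq hφabs, ← sπφ.tsum_sub]
    · exact tsum_congr fun y => by ring
    · refine (hφb.summable_mul (push_nonneg hμ0 hq) (summable_push hμ0 hfs hq)).congr fun y => ?_
      ring
  have hμQ : ∑' x, mass π x * (Q x * f x) =
      ∑' x, μ x * m x ^ 2 - ∑' x, μ x * ∑' y, φ y * q x y := by
    have hb : Bdd fun x => ∑' y, φ y * q x y := (hm2B.sub hQB).imp fun C hC x => by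
      have : |m x ^ 2 - Q x| ≤ C := hC x
      rwa [hQ x, sub_sub_cancel] at this
    rw [← sμm.tsum_sub (hb.summable_mul hμ0 hfs)]
    exact tsum_congr fun x => by rw [hQ, hμ]; ring
  set D := ∑' x, mass π x * (Q x * f x) - ∑' x, mass π x * Q x with hD
  have hB0 : 0 ≤ maxJumpRate K / κ ^ 2 * E :=
    mul_nonneg (div_nonneg (maxJumpRate_nonneg K) (sq_nonneg κ)) hE0
  have hD2 : D ^ 2 ≤ 4 * A * (maxJumpRate K / κ ^ 2 * E) := by
    have h1 := hcov.trans (mul_le_mul_of_nonneg_right hΓ hE0)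
    have e : 4 * A * (maxJumpRate K / κ ^ 2 * E) = 4 * maxJumpRate K * A * E / κ ^ 2 := by ring
    rw [e, le_div_iff₀ (by positivity)]
    linarith
  -- The arithmetic-geometric mean inequality in the form `4 A B ≤ (A + B)²`.
  have hDle : D ≤ A + maxJumpRate K / κ ^ 2 * E :=
    le_of_sq_le_sq (by nlinarith [sq_nonneg (A - maxJumpRate K / κ ^ 2 * E)])
      (add_nonneg hA0 hB0)
  rw [hpush]
  linarith

/-! ### From covering kernels to couplings, and the conclusion. -/

theorem eq_of_pmf_le {p q : PMF X} (h : ∀ x, p x ≤ q x) : p = q := by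
  have hr : ∀ x, mass p x ≤ mass q x := fun x => ENNReal.toReal_mono (q.apply_ne_top x) (h x)
  have hs := (summable_mass q).sub (summable_mass p)
  have h0 : ∑' x, (mass q x - mass p x) = 0 := by
    rw [(summable_mass q).tsum_sub (summable_mass p), tsum_mass, tsum_mass, sub_self]
  ext x
  have h1 := hs.le_tsum x fun z _ => sub_nonneg.2 (hr z)
  rw [h0] at h1
  exact (ENNReal.toReal_eq_toReal_iff' (p.apply_ne_top x) (q.apply_ne_top x)).1
    (le_antisymm (hr x) (sub_nonpos.1 h1))

/-- A sub-Markov kernel that transports `μ` onto a measure covering the probability measure `ν`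
comes from a coupling. -/
theorem weakTransportSq_le_kernelCost {d : X → X → ℝ≥0∞} (hd : ∀ x y, d x y ≠ ⊤) {μ ν : PMF X}
    {p : X → X → ℝ} (hp : p ∈ subKernel X) (hcover : ∀ y, mass ν y ≤ push (mass μ) p y) :
    weakTransportSq d ν μ ≤ kernelCost (fun x y => (d x y).toReal) (mass μ) p := by
  classical
  -- The image has mass at least `1` since it covers `ν`, and at most `∑ μ = 1`; so no row charged
  -- by `μ` can lose mass.
  have hfull : ∀ x, μ x ≠ 0 → ∑' y, p x y = 1 := by
    have sp := summable_push (mass_nonneg μ) (summable_mass μ) hp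
    have h1 : 1 ≤ ∑' y, push (mass μ) p y := by
      rw [← tsum_mass ν]
      exact (summable_mass ν).tsum_le_tsum hcover sp
    have h2 : ∑' y, push (mass μ) p y = ∑' x, mass μ x * ∑' y, p x y := by
      have := tsum_push_mul (mass_nonneg μ) (summable_mass μ) hp (φ := fun _ => 1) (C := 1)
        fun _ => by simp
      simpa only [one_mul] using this
    have hrow0 : ∀ x, 0 ≤ ∑' y, p x y := fun x => tsum_nonneg fun y => (hp x trivial).1 y
    have hrow1 : ∀ x, ∑' y, p x y ≤ 1 := fun x => tsum_le_one_of_mem_subProb (hp x trivial)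
    have hb : Bdd fun x => ∑' y, p x y := ⟨1, fun x => by
      rw [abs_of_nonneg (hrow0 x)]; exact hrow1 x⟩
    have s := (summable_mass μ).sub (hb.summable_mass_mul μ)
    have h3 : ∑' x, (mass μ x - mass μ x * ∑' y, p x y) ≤ 0 := by
      rw [(summable_mass μ).tsum_sub (hb.summable_mass_mul μ), tsum_mass, ← h2]
      linarith
    intro x hx
    have hpos : 0 < mass μ x := ENNReal.toReal_pos hx (μ.apply_ne_top x)
    have h4 := s.le_tsum x fun z _ =>
      sub_nonneg.2 (mul_le_of_le_one_right (mass_nonneg μ z) (hrow1 z))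
    refine le_antisymm (hrow1 x) ?_
    by_contra! hlt
    nlinarith [mul_lt_mul_of_pos_left hlt hpos]
  -- Rows not charged by `μ` affect neither the coupling nor the cost; a point mass fills them.
  have hrow : ∀ x, ∃ P : PMF X, μ x ≠ 0 → ∀ y, P y = ENNReal.ofReal (p x y) := fun x => by
    by_cases hx : μ x = 0
    · exact ⟨PMF.pure x, fun h => absurd hx h⟩
    · have h1 : HasSum (fun y => ENNReal.ofReal (p x y)) 1 := by
        rw [← ENNReal.ofReal_one, ← hfull x hx, ENNReal.ofReal_tsum_of_nonneg (hp x trivial).1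
          (summable_of_mem_subProb (hp x trivial))]
        exact ENNReal.summable.hasSum
      exact ⟨⟨_, h1⟩, fun _ y => rfl⟩
  choose P hP using hrow
  have hmul : ∀ x y, μ x * P x y = ENNReal.ofReal (mass μ x * p x y) := fun x y => by
    rw [ENNReal.ofReal_mul (mass_nonneg μ x), mass, ENNReal.ofReal_toReal (μ.apply_ne_top x)]
    rcases eq_or_ne (μ x) 0 with hx | hx
    · rw [hx, zero_mul, zero_mul]
    · rw [hP x hx]
  set γ : PMF (X × X) := μ.bind fun x => (P x).map (Prod.mk x) with hγ
  have hγ1 : γ.map Prod.fst = μ := by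
    rw [hγ, PMF.map_bind]
    have : ∀ x, ((P x).map (Prod.mk x)).map Prod.fst = PMF.pure x := fun x => by
      rw [PMF.map_comp]
      exact PMF.map_const (P x) x
    simp only [this, PMF.bind_pure]
  have hγ2 : γ.map Prod.snd = ν := by
    rw [hγ, PMF.map_bind]
    have : ∀ x, ((P x).map (Prod.mk x)).map Prod.snd = P x := fun x => by
      rw [PMF.map_comp]
      exact PMF.map_id (P x)
    simp only [this]
    refine (eq_of_pmf_le fun y => ?_).symm
    rw [PMF.bind_apply]
    simp only [hmul]
    rw [← ENNReal.ofReal_tsum_of_nonneg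
      (fun x => mul_nonneg (mass_nonneg μ x) ((hp x trivial).1 y))
      (summable_mul_kernel (mass_nonneg μ) (summable_mass μ) hp y),
      ← ENNReal.ofReal_toReal (ν.apply_ne_top y)]
    exact ENNReal.ofReal_le_ofReal (hcover y)
  have hγ3 : ∀ x y, γ (x, y) = μ x * P x y := fun x y => by
    rw [hγ, PMF.bind_apply, tsum_eq_single x]
    · congr 1
      rw [PMF.map_apply]
      exact (tsum_eq_single y fun z hz => if_neg fun h => hz (Prod.ext_iff.1 h).2.symm).trans
        (if_pos rfl)
    · intro z hz
      rw [PMF.map_apply]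
      exact mul_eq_zero_of_right _ (ENNReal.tsum_eq_zero.2 fun a =>
        if_neg fun h => hz (Prod.ext_iff.1 h).1.symm)
  refine (iInf₂_le_of_le γ ⟨hγ1, hγ2⟩ (iInf₂_le_of_le P hγ3 le_rfl)).trans
    (ENNReal.tsum_le_tsum fun x => ?_)
  rw [mul_comm, mass, ENNReal.ofReal_toReal (μ.apply_ne_top x)]
  rcases eq_or_ne (μ x) 0 with hx | hx
  · rw [hx, zero_mul, zero_mul]
  · refine (congrArg (fun t => μ x * t ^ 2) (tsum_congr fun y => ?_)).le
    rw [hP x hx, ENNReal.ofReal_mul ENNReal.toReal_nonneg, ENNReal.ofReal_toReal (hd x y)]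

/-- The transport-information inequality with the constant `J / κ²`. -/
theorem weakTransportSq_le_dirichletEnergy [Countable X] {K : X → PMF X} (hK : IsIrreducible K)
    {π : PMF X} (hπ : IsReversible K π) {κ : ℝ} (hκ : 0 < κ) (hCD : CurvatureDimension K κ)
    (f : X → ℝ≥0) (hf : ∑' x, (f x : ℝ≥0∞) * π x = 1)
    (hE : dirichletEnergy K π (fun x => (f x : ℝ)) ≠ ⊤) :
    weakTransportSq (graphDist K) π (withDensity π f hf) ≤
      ENNReal.ofReal (maxJumpRate K / κ ^ 2) * dirichletEnergy K π (fun x => (f x : ℝ)) := by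
  have hmass : (fun x => mass π x * (f x : ℝ)) = mass (withDensity π f hf) := by
    ext x
    change _ = ((f x : ℝ≥0∞) * π x).toReal
    rw [ENNReal.toReal_mul, mass, ENNReal.coe_toReal, mul_comm]
  have hdual := fun φ hφ0 hφ => weakTransport_dual_bound hK hπ hκ hCD (fun x => (f x).coe_nonneg)
    (hmass ▸ summable_mass _) (hmass ▸ tsum_mass _) hE (φ := φ) hφ0 hφ
  rw [hmass] at hdual
  obtain ⟨p, hp, hcost, hcover⟩ := exists_kernel_of_dual_bound (fun _ _ => ENNReal.toReal_nonneg)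
    (mass_nonneg _) (summable_mass _) (mass_nonneg π) (summable_mass π) hdual
  refine ((weakTransportSq_le_kernelCost hK.graphDist_ne_top hp hcover).trans hcost).trans_eq ?_
  rw [ENNReal.ofReal_mul (div_nonneg (maxJumpRate_nonneg K) (sq_nonneg κ)),
    ENNReal.ofReal_toReal hE]

/-- If no state is ever left, all energies vanish. -/
theorem dirichletEnergy_eq_zero {K : X → PMF X} (π : PMF X) (hJ : maxJumpRate K = 0) (f : X → ℝ) :
    dirichletEnergy K π f = 0 := by
  have h1 : ∀ x, K x x = 1 := fun x => by
    have := le_maxJumpRate K x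
    rw [hJ] at this
    rw [← ENNReal.toReal_eq_one_iff]
    exact le_antisymm (mass_le_one _ _) (sub_nonpos.1 this)
  have h2 : ∀ x y, y ≠ x → K x y = 0 := fun x y hy => by
    by_contra h
    have := (K x).apply_eq_one_iff x |>.1 (h1 x)
    exact hy (by simpa [this] using (K x).mem_support_iff y |>.2 h)
  refine ENNReal.tsum_eq_zero.2 fun x => ?_
  have : eGam K f x = 0 := by
    unfold eGam
    rw [ENNReal.tsum_eq_zero.2, mul_zero]
    intro y
    rcases eq_or_ne y x with rfl | hy
    · simp
    · rw [h2 x y hy, mul_zero]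
  rw [this, zero_mul]

end DiscreteMarkov

theorem mainTheorem8 {X : Type*} [Countable X]
    (K : X → PMF X) (hK : DiscreteMarkov.IsIrreducible K)
    (π : PMF X) (hπ : DiscreteMarkov.IsReversible K π)
    (κ : ℝ) (hκ : 0 < κ) (hCD : DiscreteMarkov.CurvatureDimension K κ)
    (f : X → ℝ≥0) (hf : ∑' x, (f x : ℝ≥0∞) * π x = 1) :
    DiscreteMarkov.weakTransportSq (DiscreteMarkov.graphDist K)
        π (DiscreteMarkov.withDensity π f hf) ≤
      ENNReal.ofReal (√2 * DiscreteMarkov.maxJumpRate K / κ ^ 2) *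
        DiscreteMarkov.dirichletEnergy K π (fun x => (f x : ℝ)) := by
  have hJ := DiscreteMarkov.maxJumpRate_nonneg K
  by_cases hE : DiscreteMarkov.dirichletEnergy K π (fun x => (f x : ℝ)) = ⊤
  -- When `J = 0` the right-hand side would be `0 * ⊤ = 0` in `ℝ≥0∞`, so infinite energy has to be
  -- ruled out in that case.
  · rcases hJ.eq_or_lt with hJ0 | hJ0
    · rw [DiscreteMarkov.dirichletEnergy_eq_zero π hJ0.symm] at hE
      exact absurd hE ENNReal.zero_ne_top
    · have : ENNReal.ofReal (√2 * DiscreteMarkov.maxJumpRate K / κ ^ 2) ≠ 0 :=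
        (ENNReal.ofReal_pos.2 (by positivity)).ne'
      rw [hE, ENNReal.mul_top this]
      exact le_top
  · refine (DiscreteMarkov.weakTransportSq_le_dirichletEnergy hK hπ hκ hCD f hf hE).trans
      (mul_le_mul_left (ENNReal.ofReal_le_ofReal ?_) _)
    have h2 : (1 : ℝ) ≤ √2 := Real.one_le_sqrt.2 (by norm_num)
    gcongr
    nlinarith
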